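/- Let $m,n\in\mathbb N$, let $\theta$ be a permutation of $\{1,\dots,m\}\times\{1,\dots,n\}$, and let $\mathbb F_\theta^+$ be the unital semigroup generated by $e_1,\dots,e_m,f_1,\dots,f_n$ subject to the relations $e_if_j=f_{j'}e_{i'}$ whenever $\theta(i,j)=(i',j')$. Representations of $\mathbb F_\theta^+$ are unital homomorphisms into the bounded operators on a complex Hilbert space. A representation $\sigma$ is a $*$-representation if every $\sigma(w)$ is an isometry and $\sum_{i}\sigma(e_i)\sigma(e_i)^*=I=\sum_{j}\sigma(f_j)\sigma(f_j)^*$. It is atomic if every $\sigma(w)$ is a partial isometry and there is an orthonormal basis such that every $\sigma(w)$ maps each basis vector $\xi$ to $a\eta$ for some basis vector $\eta$ and some scalar $a$ with $|a|=1$ or $a=0$. A $*$-representation $\pi$ on $\mathcal H$ is finitely correlated if there is a finite-dimensional subspace $\mathcal M\subseteq\mathcal H$ such that $\pi(w)^*\mathcal M\subseteq\mathcal M$ for all $w\in\mathbb F_\theta^+$ and the closed linear span of $\bigcup_w\pi(w)\mathcal M$ is $\mathcal H$. A representation is irreducible if its space is nonzero and has no closed reducing subspaces other than $0$ and the whole space.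 A representation $\pi$ on $\mathcal K$ is a dilation of $\sigma$ on $\mathcal H$ if $\mathcal H$ is (isometrically identified with) a closed subspace of $\mathcal K$ and $\sigma(w)=P_{\mathcal H}\pi(w)|_{\mathcal H}$ for all $w\in\mathbb F_\theta^+$. Let $G$ be an abelian group generated by two designated elements $\mathfrak g_1,\mathfrak g_2$. A group construction representation on $\ell^2(G)$, with standard basis $(\xi_g)_{g\in G}$, is a representation $\sigma$ of $\mathbb F_\theta^+$ of the form $$\sigma(e_i)\xi_g=\delta_{i,i_g}\,\alpha_g\,\xi_{g+\mathfrak g_1},\qquad \sigma(f_j)\xi_g=\delta_{j,j_g}\,\beta_g\,\xi_{g+\mathfrak g_2},$$ where $i_g\in\{1,\dots,m\}$, $j_g\in\{1,\dots,n\}$, $|\alpha_g|=|\beta_g|=1$, and for all $g\in G$ one has $e_{i_{g+\mathfrak g_2}}f_{j_g}=f_{j_{g+\mathfrak g_1}}e_{i_g}$ and $\alpha_{g+\mathfrak g_2}\beta_g=\beta_{g+\mathfrak g_1}\alpha_g$. **Corollary.** Every finitely correlated atomic $*$-representation of $\mathbb F_\theta^+$ is unitarily equivalent to a (Hilbert space)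 direct sum of irreducible atomic $*$-representations of $\mathbb F_\theta^+$, each of which is a dilation of a group construction representation on $\ell^2(G)$ for some finite abelian group $G$ (depending on the summand). -/

import Mathlib

open scoped InnerProductSpace

universe u

namespace TwoGraph

/-- The defining relations of the semigroup: `e_i f_j = f_{j'} e_{i'}` whenever
`θ (i, j) = (i', j')`. The letter `Sum.inl i` stands for `e_i` and `Sum.inr j` for `f_j`. -/
inductive Rel {m n : ℕ} (θ : Equiv.Perm (Fin m × Fin n)) :
    FreeMonoid (Fin m ⊕ Fin n) → FreeMonoid (Fin m ⊕ Fin n) → Prop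
  | comm (i : Fin m) (j : Fin n) : Rel θ
      (FreeMonoid.of (Sum.inl i) * FreeMonoid.of (Sum.inr j))
      (FreeMonoid.of (Sum.inr (θ (i, j)).2) * FreeMonoid.of (Sum.inl (θ (i, j)).1))

/-- The unital semigroup `𝔽_θ⁺` of a single-vertex rank 2 graph. -/
abbrev FTheta {m n : ℕ} (θ : Equiv.Perm (Fin m × Fin n)) : Type := PresentedMonoid (Rel θ)

/-- The generator `e_i`. -/
def e {m n : ℕ} (θ : Equiv.Perm (Fin m × Fin n)) (i : Fin m) : FTheta θ :=
  PresentedMonoid.of (Rel θ) (Sum.inl i)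

/-- The generator `f_j`. -/
def f {m n : ℕ} (θ : Equiv.Perm (Fin m × Fin n)) (j : Fin n) : FTheta θ :=
  PresentedMonoid.of (Rel θ) (Sum.inr j)

/-- Representations of `𝔽_θ⁺` by bounded operators on `H`. -/
abbrev Rep {m n : ℕ} (θ : Equiv.Perm (Fin m × Fin n)) (H : Type*)
    [NormedAddCommGroup H] [InnerProductSpace ℂ H] := FTheta θ →* (H →L[ℂ] H)

section Rep

variable {m n : ℕ} {θ : Equiv.Perm (Fin m × Fin n)}
  {H : Type*} [NormedAddCommGroup H] [InnerProductSpace ℂ H] [CompleteSpace H]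

/-- Every operator `σ w` is a partial isometry. -/
def IsPartiallyIsometric (σ : Rep θ H) : Prop :=
  ∀ w, σ w * ContinuousLinearMap.adjoint (σ w) * σ w = σ w

/-- Every operator `σ w` is an isometry. -/
def IsIsometric (σ : Rep θ H) : Prop :=
  ∀ w x, ‖σ w x‖ = ‖x‖

/-- `∑ σ(e_i) σ(e_i)* = I = ∑ σ(f_j) σ(f_j)*`. -/
def IsDefectFree (σ : Rep θ H) : Prop :=
  (∑ i : Fin m, σ (e θ i) * ContinuousLinearMap.adjoint (σ (e θ i)) = 1) ∧
  (∑ j : Fin n, σ (f θ j) * ContinuousLinearMap.adjoint (σ (f θ j)) = 1)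

/-- A `*`-representation: isometric and defect free. -/
def IsStarRep (σ : Rep θ H) : Prop :=
  IsIsometric σ ∧ IsDefectFree σ

/-- A partially isometric representation is atomic if some orthonormal basis is permuted up to
scalars in `𝕋 ∪ {0}` by every `σ w`. -/
def IsAtomic {H : Type u} [NormedAddCommGroup H] [InnerProductSpace ℂ H] [CompleteSpace H]
    (σ : Rep θ H) : Prop :=
  IsPartiallyIsometric σ ∧
    ∃ (κ : Type u) (ξ : HilbertBasis κ ℂ H), ∀ (w : FTheta θ) (k : κ),
      ∃ (l : κ) (a : ℂ), (‖a‖ = 1 ∨ a = 0) ∧ σ w (ξ k) = a • ξ l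

/-- `M` is coinvariant: `σ(w)* M ⊆ M` for all `w`. -/
def IsCoinvariant (σ : Rep θ H) (M : Submodule ℂ H) : Prop :=
  ∀ w, ∀ x ∈ M, ContinuousLinearMap.adjoint (σ w) x ∈ M

/-- `M` is cyclic: the closed span of the subspaces `σ(w) M` is the whole space. -/
def IsCyclicSubspace (σ : Rep θ H) (M : Submodule ℂ H) : Prop :=
  (⨆ w : FTheta θ, M.map (σ w).toLinearMap).topologicalClosure = ⊤

/-- There is a finite dimensional coinvariant cyclic subspace. -/
def IsFinitelyCorrelated (σ : Rep θ H) : Prop :=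
  ∃ M : Submodule ℂ H, FiniteDimensional ℂ M ∧ IsCoinvariant σ M ∧ IsCyclicSubspace σ M

/-- `σ` acts on a nonzero space and has no reducing closed subspace besides `0` and the whole
space. -/
def IsIrreducible (σ : Rep θ H) : Prop :=
  Nontrivial H ∧ ∀ M : Submodule ℂ H, IsClosed (M : Set H) →
    (∀ w, ∀ x ∈ M, σ w x ∈ M) → IsCoinvariant σ M → M = ⊥ ∨ M = ⊤

/-- `π` on `K` is a dilation of `σ` on `H`: after an isometric identification of `H` with a
closed subspace of `K`, `σ(w)` is the compression of `π(w)` to `H` for all `w`. -/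
def IsDilation {K : Type*} [NormedAddCommGroup K] [InnerProductSpace ℂ K] [CompleteSpace K]
    (π : Rep θ K) (σ : Rep θ H) : Prop :=
  ∃ V : H →ₗᵢ[ℂ] K, ∀ w, σ w =
    ContinuousLinearMap.adjoint V.toContinuousLinearMap ∘L π w ∘L V.toContinuousLinearMap

/-- `π` is unitarily equivalent to the Hilbert space direct sum of the representations `ρ i`,
which acts coordinatewise on the `ℓ²`-direct sum of the spaces `K i`. -/
def IsUnitarilyEquivalentToDirectSum {ι : Type*} {K : ι → Type*}
    [∀ i, NormedAddCommGroup (K i)] [∀ i, InnerProductSpace ℂ (K i)]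
    (π : Rep θ H) (ρ : ∀ i, Rep θ (K i)) : Prop :=
  ∃ U : H ≃ₗᵢ[ℂ] lp K 2, ∀ (w : FTheta θ) (x : H) (i : ι), U (π w x) i = ρ i w (U x i)

end Rep

/-- The data of a group construction on an abelian group `G`: two designated generators of `G`,
edge labels `i_g`, `j_g` and unimodular scalars `α_g`, `β_g`, subject to
`e_{i_{g+g₂}} f_{j_g} = f_{j_{g+g₁}} e_{i_g}` and `α_{g+g₂} β_g = β_{g+g₁} α_g`. -/
structure GroupData {m n : ℕ} (θ : Equiv.Perm (Fin m × Fin n)) (G : Type*) [AddCommGroup G] where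
  g₁ : G
  g₂ : G
  generate : AddSubgroup.closure {g₁, g₂} = (⊤ : AddSubgroup G)
  i : G → Fin m
  j : G → Fin n
  α : G → Circle
  β : G → Circle
  comm_word : ∀ g, e θ (i (g + g₂)) * f θ (j g) = f θ (j (g + g₁)) * e θ (i g)
  comm_scalar : ∀ g, α (g + g₂) * β g = β (g + g₁) * α g

/-- The standard basis vector `ξ_g` of `ℓ²(G)`. -/
noncomputable def stdVec {G : Type*} (g : G) : lp (fun _ : G => ℂ) 2 :=
  open Classical in lp.single 2 g (1 : ℂ)

/-- `σ` is a group construction representation on `ℓ²(G)`: for some data as above,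
`σ(e_i) ξ_g = δ_{i i_g} α_g ξ_{g+g₁}` and `σ(f_j) ξ_g = δ_{j j_g} β_g ξ_{g+g₂}`. -/
def IsGroupConstruction {m n : ℕ} {θ : Equiv.Perm (Fin m × Fin n)} {G : Type*} [AddCommGroup G]
    (σ : Rep θ (lp (fun _ : G => ℂ) 2)) : Prop :=
  ∃ D : GroupData θ G, ∀ g : G,
    (∀ i : Fin m, σ (e θ i) (stdVec g) =
      if i = D.i g then (D.α g : ℂ) • stdVec (g + D.g₁) else 0) ∧
    (∀ j : Fin n, σ (f θ j) (stdVec g) =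
      if j = D.j g then (D.β g : ℂ) • stdVec (g + D.g₂) else 0)

end TwoGraph

/-!
The operators `P = ∑ π(e_i)*` and `Q = ∑ π(f_j)*` are bounded and commute, because `θ` matches the
words `e_i f_j` with the words `f_j e_i`. They perform backward steps: if `v` lies in the range of
`π(e_i)`, then `P v = π(e_i)* v`. A vector all of whose backward steps `P ^ s Q ^ t v` lie in the
range of a single `π(e_i)` and a single `π(f_j)` is labelled by the infinite word of these `i` and
`j`. The vectors labelled by a word `x` form the subspace `wordSpace π x`; it is preserved by the
operators commuting with `π` and `π*`, the backward steps are isometric on it, and different words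
have orthogonal subspaces (`inner_eq_zero_of_word_ne`). The basis vectors of an atomic
representation are labelled in this way.

A summand is generated by a unit vector `η`, labelled by a word `x` periodic in both directions, for
which every backward step fixing `x` multiplies `η` by a scalar (`IsPeriodicEigenvector`). The
labelled unit vectors whose backward orbit meets that of `η` are permuted up to scalars by `π`, and
two of them are parallel or orthogonal according to whether their words agree. Their closed span
`orbitSpace π η` is therefore reducing and atomic. It is irreducible because the projection onto a
smaller reducing subspace maps `η` to a vector with the same word, hence to a multiple of `η`. The
positions of `x` form a finite torus; modulo the translations that preserve `x` they form a finite
abelian group `G`, and the corresponding vectors `P ^ s Q ^ t η` are orthonormal and span a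
coinvariant subspace, on which the compression is a group construction representation
(`exists_groupConstruction`).

Periodic eigenvectors exist in every nonzero reducing subspace `N`
(`exists_isPeriodicEigenvector`). Let `M` be a finite dimensional cyclic coinvariant subspace. The
norms of the projections of the basis vectors to `M` are square summable, and they do not decrease
along backward steps, so a basis vector that is not orthogonal to `M` has a finite backward orbit.
Such a vector can be chosen not orthogonal to `N`, and after some backward steps its word is
periodic. The backward steps that fix this word commute and act on a finite dimensional subspace of
`N`, where they have a common eigenvector. Zorn's lemma then splits the whole space into orbit
spaces of periodic eigenvectors (`exists_isHilbertSum_reducing`).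
-/

namespace TwoGraph

open ContinuousLinearMap (adjoint adjoint_inner_left adjoint_inner_right)

/-! ### Families of isometries with complementary ranges -/

section CuntzFamily

variable {ι : Type*} [Fintype ι]
  {H : Type*} [NormedAddCommGroup H] [InnerProductSpace ℂ H] [CompleteSpace H]

/-- A finite family of isometries `S i` with `∑ S i (S i)* = 1`. -/
structure IsCuntzFamily (S : ι → H →L[ℂ] H) : Prop where
  isometry : ∀ i x, ‖S i x‖ = ‖x‖
  sum_eq_one : ∑ i, S i * adjoint (S i) = 1

/-- The operator `∑ (S i)*`. On a vector in the range of a single `S i` it inverts `S i`. -/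
noncomputable def down (S : ι → H →L[ℂ] H) : H →L[ℂ] H := ∑ i, adjoint (S i)

omit [CompleteSpace H] in
lemma inner_map_map_of_isometry {T : H →L[ℂ] H} (hT : ∀ x, ‖T x‖ = ‖x‖) (x y : H) :
    ⟪T x, T y⟫_ℂ = ⟪x, y⟫_ℂ :=
  (LinearIsometry.mk T.toLinearMap hT).inner_map_map x y

lemma adjoint_apply_of_isometry {T : H →L[ℂ] H} (hT : ∀ x, ‖T x‖ = ‖x‖) (x : H) :
    adjoint T (T x) = x := by
  refine ext_inner_right ℂ fun y => ?_
  rw [adjoint_inner_left, inner_map_map_of_isometry hT]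

namespace IsCuntzFamily

variable {S : ι → H →L[ℂ] H} (hS : IsCuntzFamily S)
include hS

lemma sum_apply (x : H) : ∑ i, S i (adjoint (S i) x) = x := by
  have := congrArg (fun T : H →L[ℂ] H => T x) hS.sum_eq_one
  simpa using this

lemma sum_norm_sq (x : H) : ∑ i, ‖adjoint (S i) x‖ ^ 2 = ‖x‖ ^ 2 := by
  have h : ∑ i, ⟪adjoint (S i) x, adjoint (S i) x⟫_ℂ = ⟪x, x⟫_ℂ := by
    conv_rhs => rw [← hS.sum_apply x]
    rw [hS.sum_apply x]
    conv_rhs => rw [← hS.sum_apply x, sum_inner]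
    refine Finset.sum_congr rfl fun i _ => ?_
    rw [hS.sum_apply x, adjoint_inner_right]
  simp only [inner_self_eq_norm_sq_to_K] at h
  exact_mod_cast h

lemma adjoint_apply_self (i : ι) (x : H) : adjoint (S i) (S i x) = x :=
  adjoint_apply_of_isometry (hS.isometry i) x

lemma adjoint_apply_of_ne {i j : ι} (hij : i ≠ j) (x : H) : adjoint (S i) (S j x) = 0 := by
  classical
  have h := hS.sum_norm_sq (S j x)
  rw [← Finset.add_sum_erase _ _ (Finset.mem_univ j), hS.adjoint_apply_self, hS.isometry] at h
  have h0 : ∑ i ∈ Finset.univ.erase j, ‖adjoint (S i) (S j x)‖ ^ 2 = 0 := by linarith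
  rw [Finset.sum_eq_zero_iff_of_nonneg fun _ _ => by positivity] at h0
  simpa using h0 i (by simp [hij])

lemma down_apply (i : ι) (x : H) : down S (S i x) = x := by
  classical
  simp only [down, _root_.sum_apply]
  rw [Finset.sum_eq_single i (fun j _ hj => hS.adjoint_apply_of_ne hj x) (by simp),
    hS.adjoint_apply_self]

lemma adjoint_apply_eq {i : ι} {x : H} (hx : S i (down S x) = x) :
    adjoint (S i) x = down S x := by
  conv_lhs => rw [← hx, hS.adjoint_apply_self]

lemma adjoint_apply_eq_zero {i j : ι} (hij : i ≠ j) {x : H} (hx : S j (down S x) = x) :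
    adjoint (S i) x = 0 := by
  rw [← hx, hS.adjoint_apply_of_ne hij]

lemma inner_down_down {i : ι} {x y : H} (hx : S i (down S x) = x) (hy : S i (down S y) = y) :
    ⟪down S x, down S y⟫_ℂ = ⟪x, y⟫_ℂ := by
  conv_rhs => rw [← hx, ← hy, inner_map_map_of_isometry (hS.isometry i)]

lemma inner_eq_zero_of_ne {i j : ι} (hij : i ≠ j) {x y : H} (hx : S i (down S x) = x)
    (hy : S j (down S y) = y) : ⟪x, y⟫_ℂ = 0 := by
  rw [← hx, ← adjoint_inner_right, hS.adjoint_apply_eq_zero hij hy, inner_zero_right]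

end IsCuntzFamily

end CuntzFamily

/-! ### Generators of the semigroup and reducing subspaces -/

section Generators

variable {m n : ℕ} {θ : Equiv.Perm (Fin m × Fin n)}

lemma e_mul_f (i : Fin m) (j : Fin n) :
    e θ i * f θ j = f θ (θ (i, j)).2 * e θ (θ (i, j)).1 :=
  PresentedMonoid.mk_eq_mk_of_rel (Rel.comm i j)

lemma FTheta.induction {p : FTheta θ → Prop} (one : p 1) (e_mul : ∀ i w, p w → p (e θ i * w))
    (f_mul : ∀ j w, p w → p (f θ j * w)) (w : FTheta θ) : p w := by
  induction w using PresentedMonoid.inductionOn with | _ a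
  induction a using FreeMonoid.inductionOn' with
  | one => exact one
  | of_mul x a ih =>
    rw [map_mul]
    cases x with
    | inl i => exact e_mul i _ ih
    | inr j => exact f_mul j _ ih

variable {H : Type*} [NormedAddCommGroup H] [InnerProductSpace ℂ H] [CompleteSpace H]
  {π : Rep θ H}

lemma IsStarRep.cuntz_e (hπ : IsStarRep π) : IsCuntzFamily fun i => π (e θ i) :=
  ⟨fun _ => hπ.1 _, hπ.2.1⟩

lemma IsStarRep.cuntz_f (hπ : IsStarRep π) : IsCuntzFamily fun j => π (f θ j) :=
  ⟨fun _ => hπ.1 _, hπ.2.2⟩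

omit [CompleteSpace H] in
lemma map_e_map_f (i : Fin m) (j : Fin n) (v : H) :
    π (e θ i) (π (f θ j) v) = π (f θ (θ (i, j)).2) (π (e θ (θ (i, j)).1) v) := by
  have := congrArg (fun w => π w v) (e_mul_f (θ := θ) i j)
  simpa using this

omit [CompleteSpace H] in
lemma map_f_map_e (i : Fin m) (j : Fin n) (v : H) :
    π (f θ j) (π (e θ i) v) = π (e θ (θ.symm (i, j)).1) (π (f θ (θ.symm (i, j)).2) v) := by
  rw [map_e_map_f]
  simp

/-- A closed subspace invariant under every `π w` and every `(π w)*`. -/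
structure IsReducing (π : Rep θ H) (M : Submodule ℂ H) : Prop where
  isClosed : IsClosed (M : Set H)
  map_mem : ∀ w, ∀ x ∈ M, π w x ∈ M
  coinvariant : IsCoinvariant π M

/-- An operator commuting with every `π w` and every `(π w)*`. -/
structure IsIntertwining (π : Rep θ H) (R : H →L[ℂ] H) : Prop where
  map_comm : ∀ w v, R (π w v) = π w (R v)
  adjoint_comm : ∀ w v, R (adjoint (π w) v) = adjoint (π w) (R v)

lemma starProjection_comm_of_mem {M : Submodule ℂ H} [M.HasOrthogonalProjection]
    {T : H →L[ℂ] H} (hT : ∀ x ∈ M, T x ∈ M) (hT' : ∀ x ∈ M, adjoint T x ∈ M) (v : H) :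
    M.starProjection (T v) = T (M.starProjection v) := by
  refine (Submodule.eq_starProjection_of_mem_of_inner_eq_zero
    (hT _ (M.starProjection_apply_mem v)) fun y hy => ?_)
  rw [← map_sub, ← adjoint_inner_right]
  exact M.starProjection_inner_eq_zero _ _ (hT' y hy)

lemma IsReducing.intertwining {M : Submodule ℂ H} [M.HasOrthogonalProjection]
    (hM : IsReducing π M) : IsIntertwining π M.starProjection where
  map_comm w := starProjection_comm_of_mem (hM.map_mem w) (hM.coinvariant w)
  adjoint_comm w := starProjection_comm_of_mem (hM.coinvariant w) fun x hx => by
    simpa using hM.map_mem w x hx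

lemma IsReducing.hasOrthogonalProjection {M : Submodule ℂ H} (hM : IsReducing π M) :
    M.HasOrthogonalProjection :=
  haveI := hM.isClosed.completeSpace_coe
  inferInstance

lemma IsReducing.orthogonal {M : Submodule ℂ H} (hM : IsReducing π M) : IsReducing π Mᗮ where
  isClosed := M.isClosed_orthogonal
  map_mem w x hx := (M.mem_orthogonal _).2 fun y hy => by
    rw [← adjoint_inner_left]
    exact (M.mem_orthogonal _).1 hx _ (hM.coinvariant w y hy)
  coinvariant w x hx := (M.mem_orthogonal _).2 fun y hy => by
    rw [adjoint_inner_right]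
    exact (M.mem_orthogonal _).1 hx _ (hM.map_mem w y hy)

/-- It suffices to test on a total set of vectors and on the generators of the semigroup. -/
lemma isReducing_topologicalClosure_span {B : Set H}
    (he : ∀ i, ∀ v ∈ B, π (e θ i) v ∈ Submodule.span ℂ B)
    (hf : ∀ j, ∀ v ∈ B, π (f θ j) v ∈ Submodule.span ℂ B)
    (he' : ∀ i, ∀ v ∈ B, adjoint (π (e θ i)) v ∈ Submodule.span ℂ B)
    (hf' : ∀ j, ∀ v ∈ B, adjoint (π (f θ j)) v ∈ Submodule.span ℂ B) :
    IsReducing π (Submodule.span ℂ B).topologicalClosure := by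
  have key : ∀ T : H →L[ℂ] H, (∀ v ∈ B, T v ∈ Submodule.span ℂ B) →
      ∀ x ∈ (Submodule.span ℂ B).topologicalClosure,
        T x ∈ (Submodule.span ℂ B).topologicalClosure := by
    intro T hT x hx
    have h1 : Submodule.span ℂ B ≤ (Submodule.span ℂ B).comap T.toLinearMap :=
      Submodule.span_le.2 hT
    exact map_mem_closure T.continuous hx fun y hy => h1 hy
  refine ⟨Submodule.isClosed_topologicalClosure _, fun w => ?_, fun w => ?_⟩
  · induction w using FTheta.induction with
    | one => simp
    | e_mul i w ih => intro x hx; rw [map_mul]; exact key _ (he i) _ (ih x hx)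
    | f_mul j w ih => intro x hx; rw [map_mul]; exact key _ (hf j) _ (ih x hx)
  · induction w using FTheta.induction with
    | one =>
      intro x hx
      rw [map_one, ← ContinuousLinearMap.star_eq_adjoint, star_one]
      exact hx
    | e_mul i w ih =>
      intro x hx
      rw [map_mul, ContinuousLinearMap.mul_def, ContinuousLinearMap.adjoint_comp]
      exact ih _ (key _ (he' i) _ hx)
    | f_mul j w ih =>
      intro x hx
      rw [map_mul, ContinuousLinearMap.mul_def, ContinuousLinearMap.adjoint_comp]
      exact ih _ (key _ (hf' j) _ hx)

end Generators

/-! ### Infinite words and the vectors they label -/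

section Words

/-- An infinite word: `x s t` holds the labels of the `e`-edge and of the `f`-edge entering the
vertex reached by `s` backward `e`-steps and `t` backward `f`-steps. -/
abbrev InfWord (m n : ℕ) : Type := ℕ → ℕ → Fin m × Fin n

/-- The infinite word seen after `s` backward `e`-steps and `t` backward `f`-steps. -/
def InfWord.shift {m n : ℕ} (s t : ℕ) (x : InfWord m n) : InfWord m n :=
  fun a b => x (a + s) (b + t)

lemma InfWord.shift_shift {m n : ℕ} (s t s' t' : ℕ) (x : InfWord m n) :
    (x.shift s' t').shift s t = x.shift (s + s') (t + t') := by
  funext a b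
  simp [InfWord.shift, add_assoc]

variable {m n : ℕ} {θ : Equiv.Perm (Fin m × Fin n)}
  {H : Type*} [NormedAddCommGroup H] [InnerProductSpace ℂ H] [CompleteSpace H]

/-- `∑ π(e_i)*`, the backward step along `e`-edges. -/
noncomputable def downE (π : Rep θ H) : H →L[ℂ] H := down fun i => π (e θ i)

/-- `∑ π(f_j)*`, the backward step along `f`-edges. -/
noncomputable def downF (π : Rep θ H) : H →L[ℂ] H := down fun j => π (f θ j)

/-- The operator performing `s` backward `e`-steps and `t` backward `f`-steps. -/
noncomputable def shiftOp (π : Rep θ H) (s t : ℕ) : H →L[ℂ] H := downE π ^ s * downF π ^ t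

/-- The backward steps commute because `θ` permutes the words `e_i f_j` and `f_j e_i`. -/
lemma commute_downE_downF (π : Rep θ H) : Commute (downE π) (downF π) := by
  have h1 : ∀ w w', adjoint (π w) * adjoint (π w') = adjoint (π (w' * w)) := fun w w' => by
    rw [map_mul, ContinuousLinearMap.mul_def, ContinuousLinearMap.mul_def,
      ContinuousLinearMap.adjoint_comp]
  simp only [Commute, SemiconjBy, downE, downF, down, Finset.sum_mul, Finset.mul_sum, h1]
  rw [Finset.sum_comm, ← Fintype.sum_prod_type' (fun i j => adjoint (π (f θ j * e θ i))),
    ← Fintype.sum_prod_type' (fun i j => adjoint (π (e θ i * f θ j))),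
    ← Equiv.sum_comp θ]
  exact Finset.sum_congr rfl fun x _ => by rw [← e_mul_f]

variable {π : Rep θ H}

lemma shiftOp_shiftOp (s t s' t' : ℕ) (v : H) :
    shiftOp π s t (shiftOp π s' t' v) = shiftOp π (s + s') (t + t') v := by
  have h : shiftOp π s t * shiftOp π s' t' = shiftOp π (s + s') (t + t') := by
    have := ((commute_downE_downF π).pow_pow s' t).eq
    simp only [shiftOp, pow_add, mul_assoc]
    rw [← mul_assoc (downF π ^ t), ← this, mul_assoc]
  rw [← h]; rfl

lemma shiftOp_zero (v : H) : shiftOp π 0 0 v = v := by simp [shiftOp]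

lemma downE_eq_shiftOp (v : H) : downE π v = shiftOp π 1 0 v := by simp [shiftOp]

lemma downF_eq_shiftOp (v : H) : downF π v = shiftOp π 0 1 v := by simp [shiftOp]

lemma downE_shiftOp (s t : ℕ) (v : H) :
    downE π (shiftOp π s t v) = shiftOp π (s + 1) t v := by
  rw [downE_eq_shiftOp, shiftOp_shiftOp, add_comm 1 s, zero_add]

lemma downF_shiftOp (s t : ℕ) (v : H) :
    downF π (shiftOp π s t v) = shiftOp π s (t + 1) v := by
  rw [downF_eq_shiftOp, shiftOp_shiftOp, add_comm 1 t, zero_add]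

lemma shiftOp_comm (s t s' t' : ℕ) (v : H) :
    shiftOp π s t (shiftOp π s' t' v) = shiftOp π s' t' (shiftOp π s t v) := by
  rw [shiftOp_shiftOp, shiftOp_shiftOp, add_comm s, add_comm t]

/-- The space of the vectors `v` all of whose backward steps `shiftOp π s t v` lie in the ranges of
`π(e_i)` and `π(f_j)`, where `(i, j) = x s t`. -/
def wordSpace (π : Rep θ H) (x : InfWord m n) : Submodule ℂ H where
  carrier := {v | ∀ s t, π (e θ (x s t).1) (downE π (shiftOp π s t v)) = shiftOp π s t v ∧
    π (f θ (x s t).2) (downF π (shiftOp π s t v)) = shiftOp π s t v}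
  zero_mem' := by simp
  add_mem' hv hw s t := by simp [hv s t, hw s t]
  smul_mem' c v hv s t := by simp [hv s t]

variable {x y : InfWord m n} {v v' : H}

lemma map_e_downE (hv : v ∈ wordSpace π x) : π (e θ (x 0 0).1) (downE π v) = v := by
  simpa [shiftOp_zero] using (hv 0 0).1

lemma map_f_downF (hv : v ∈ wordSpace π x) : π (f θ (x 0 0).2) (downF π v) = v := by
  simpa [shiftOp_zero] using (hv 0 0).2

lemma shiftOp_mem_wordSpace (s t : ℕ) (hv : v ∈ wordSpace π x) :
    shiftOp π s t v ∈ wordSpace π (x.shift s t) := by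
  intro a b
  rw [shiftOp_shiftOp]
  exact hv (a + s) (b + t)

lemma IsIntertwining.downE_comm {R : H →L[ℂ] H} (hR : IsIntertwining π R) (v : H) :
    R (downE π v) = downE π (R v) := by
  simp [downE, down, hR.adjoint_comm]

lemma IsIntertwining.downF_comm {R : H →L[ℂ] H} (hR : IsIntertwining π R) (v : H) :
    R (downF π v) = downF π (R v) := by
  simp [downF, down, hR.adjoint_comm]

lemma IsIntertwining.shiftOp_comm {R : H →L[ℂ] H} (hR : IsIntertwining π R) (s t : ℕ) (v : H) :
    R (shiftOp π s t v) = shiftOp π s t (R v) := by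
  induction s with
  | zero =>
    induction t with
    | zero => simp [shiftOp_zero]
    | succ t ih => rw [← downF_shiftOp, hR.downF_comm, ih, downF_shiftOp]
  | succ s ih => rw [← downE_shiftOp, hR.downE_comm, ih, downE_shiftOp]

lemma IsIntertwining.mem_wordSpace {R : H →L[ℂ] H} (hR : IsIntertwining π R)
    (hv : v ∈ wordSpace π x) : R v ∈ wordSpace π x := by
  intro s t
  rw [← hR.shiftOp_comm, ← hR.downE_comm, ← hR.downF_comm, ← hR.map_comm, ← hR.map_comm,
    (hv s t).1, (hv s t).2]
  exact ⟨rfl, rfl⟩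

variable (hπ : IsStarRep π)
include hπ

lemma inner_shiftOp_shiftOp (s t : ℕ) (hv : v ∈ wordSpace π x) (hv' : v' ∈ wordSpace π x) :
    ⟪shiftOp π s t v, shiftOp π s t v'⟫_ℂ = ⟪v, v'⟫_ℂ := by
  induction s with
  | zero =>
    induction t with
    | zero => simp [shiftOp_zero]
    | succ t ih =>
      rw [← downF_shiftOp, ← downF_shiftOp, ← ih]
      exact hπ.cuntz_f.inner_down_down (hv 0 t).2 (hv' 0 t).2
  | succ s ih =>
    rw [← downE_shiftOp, ← downE_shiftOp, ← ih]
    exact hπ.cuntz_e.inner_down_down (hv s t).1 (hv' s t).1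

lemma norm_shiftOp (s t : ℕ) (hv : v ∈ wordSpace π x) : ‖shiftOp π s t v‖ = ‖v‖ := by
  rw [← sq_eq_sq₀ (norm_nonneg _) (norm_nonneg _)]
  have h := inner_shiftOp_shiftOp hπ s t hv hv
  simp only [inner_self_eq_norm_sq_to_K] at h
  exact_mod_cast h

lemma eq_of_shiftOp_eq (s t : ℕ) (hv : v ∈ wordSpace π x) (hv' : v' ∈ wordSpace π x)
    (h : shiftOp π s t v = shiftOp π s t v') : v = v' := by
  rw [← sub_eq_zero, ← norm_eq_zero, ← norm_shiftOp hπ s t (sub_mem hv hv'), map_sub, h]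
  simp

/-- Vectors labelled by different infinite words are orthogonal: backward steps preserve the inner
product up to the first position at which the labels differ, and there it vanishes. -/
lemma inner_eq_zero_of_word_ne (hxy : x ≠ y) (hv : v ∈ wordSpace π x)
    (hv' : v' ∈ wordSpace π y) : ⟪v, v'⟫_ℂ = 0 := by
  by_contra h0
  have key : ∀ s t, ⟪shiftOp π s t v, shiftOp π s t v'⟫_ℂ ≠ 0 → x s t = y s t := by
    intro s t h
    refine Prod.ext ?_ ?_ <;> by_contra hne
    · exact h (hπ.cuntz_e.inner_eq_zero_of_ne hne (hv s t).1 (hv' s t).1)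
    · exact h (hπ.cuntz_f.inner_eq_zero_of_ne hne (hv s t).2 (hv' s t).2)
  have hne : ∀ s t, ⟪shiftOp π s t v, shiftOp π s t v'⟫_ℂ ≠ 0 := by
    intro s t
    induction s with
    | zero =>
      induction t with
      | zero => simpa [shiftOp_zero] using h0
      | succ t ih =>
        have h1 := hπ.cuntz_f.inner_down_down (hv 0 t).2 (by rw [key 0 t ih]; exact (hv' 0 t).2)
        rw [← downF_shiftOp, ← downF_shiftOp]
        exact fun h => ih (h1.symm.trans h)
    | succ s ih =>
      have h1 := hπ.cuntz_e.inner_down_down (hv s t).1 (by rw [key s t ih]; exact (hv' s t).1)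
      rw [← downE_shiftOp, ← downE_shiftOp]
      exact fun h => ih (h1.symm.trans h)
  exact hxy (funext fun s => funext fun t => key s t (hne s t))

lemma word_unique (hv : v ∈ wordSpace π x) (hv' : v ∈ wordSpace π y) (h0 : v ≠ 0) : x = y := by
  by_contra h
  exact h0 (inner_self_eq_zero.1 (inner_eq_zero_of_word_ne hπ h hv hv'))

lemma downE_map_e (i : Fin m) (v : H) : downE π (π (e θ i) v) = v := hπ.cuntz_e.down_apply i v

lemma downF_map_f (j : Fin n) (v : H) : downF π (π (f θ j) v) = v := hπ.cuntz_f.down_apply j v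

lemma downF_map_e {j : Fin n} (hv : π (f θ j) (downF π v) = v) (i : Fin m) :
    downF π (π (e θ i) v) = π (e θ (θ (i, j)).1) (downF π v) ∧
      π (f θ (θ (i, j)).2) (downF π (π (e θ i) v)) = π (e θ i) v := by
  have h : π (e θ i) v = π (f θ (θ (i, j)).2) (π (e θ (θ (i, j)).1) (downF π v)) := by
    rw [← map_e_map_f, hv]
  rw [h, downF_map_f hπ]
  exact ⟨rfl, rfl⟩

lemma downE_map_f {i : Fin m} (hv : π (e θ i) (downE π v) = v) (j : Fin n) :
    downE π (π (f θ j) v) = π (f θ (θ.symm (i, j)).2) (downE π v) ∧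
      π (e θ (θ.symm (i, j)).1) (downE π (π (f θ j) v)) = π (f θ j) v := by
  have h : π (f θ j) v = π (e θ (θ.symm (i, j)).1) (π (f θ (θ.symm (i, j)).2) (downE π v)) := by
    rw [← map_f_map_e, hv]
  rw [h, downE_map_e hπ]
  exact ⟨rfl, rfl⟩

lemma exists_word_map_e (hv : v ∈ wordSpace π x) (i : Fin m) :
    ∃ y, π (e θ i) v ∈ wordSpace π y := by
  have h0 : ∀ t, ∃ i', shiftOp π 0 t (π (e θ i) v) = π (e θ i') (shiftOp π 0 t v) := by
    intro t
    induction t with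
    | zero => exact ⟨i, by simp [shiftOp_zero]⟩
    | succ t ih =>
      obtain ⟨i', h⟩ := ih
      rw [← downF_shiftOp, h, (downF_map_e hπ (hv 0 t).2 i').1, downF_shiftOp]
      exact ⟨_, rfl⟩
  have h : ∀ s t, ∃ l : Fin m × Fin n,
      π (e θ l.1) (downE π (shiftOp π s t (π (e θ i) v))) = shiftOp π s t (π (e θ i) v) ∧
      π (f θ l.2) (downF π (shiftOp π s t (π (e θ i) v))) = shiftOp π s t (π (e θ i) v) := by
    intro s t
    cases s with
    | zero =>
      obtain ⟨i', h⟩ := h0 t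
      rw [h, downE_map_e hπ]
      exact ⟨(i', _), rfl, (downF_map_e hπ (hv 0 t).2 i').2⟩
    | succ s =>
      have h1 : shiftOp π (s + 1) t (π (e θ i) v) = shiftOp π s t v := by
        conv_rhs => rw [← downE_map_e hπ i v, downE_eq_shiftOp, shiftOp_shiftOp]
        rw [add_zero]
      rw [h1]
      exact ⟨x s t, hv s t⟩
  choose y hy using h
  exact ⟨y, hy⟩

lemma exists_word_map_f (hv : v ∈ wordSpace π x) (j : Fin n) :
    ∃ y, π (f θ j) v ∈ wordSpace π y := by
  have h0 : ∀ s, ∃ j', shiftOp π s 0 (π (f θ j) v) = π (f θ j') (shiftOp π s 0 v) := by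
    intro s
    induction s with
    | zero => exact ⟨j, by simp [shiftOp_zero]⟩
    | succ s ih =>
      obtain ⟨j', h⟩ := ih
      rw [← downE_shiftOp, h, (downE_map_f hπ (hv s 0).1 j').1, downE_shiftOp]
      exact ⟨_, rfl⟩
  have h : ∀ s t, ∃ l : Fin m × Fin n,
      π (e θ l.1) (downE π (shiftOp π s t (π (f θ j) v))) = shiftOp π s t (π (f θ j) v) ∧
      π (f θ l.2) (downF π (shiftOp π s t (π (f θ j) v))) = shiftOp π s t (π (f θ j) v) := by
    intro s t
    cases t with
    | zero =>
      obtain ⟨j', h⟩ := h0 s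
      rw [h, downF_map_f hπ]
      exact ⟨(_, j'), (downE_map_f hπ (hv s 0).1 j').2, rfl⟩
    | succ t =>
      have h1 : shiftOp π s (t + 1) (π (f θ j) v) = shiftOp π s t v := by
        conv_rhs => rw [← downF_map_f hπ j v, downF_eq_shiftOp, shiftOp_shiftOp]
        rw [add_zero]
      rw [h1]
      exact ⟨x s t, hv s t⟩
  choose y hy using h
  exact ⟨y, hy⟩

end Words

/-! ### Periodic eigenvectors and the spaces they generate -/

section Orbit

variable {m n : ℕ} {θ : Equiv.Perm (Fin m × Fin n)}
  {H : Type*} [NormedAddCommGroup H] [InnerProductSpace ℂ H] [CompleteSpace H]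

/-- A unit vector `η` labelled by an infinite word `x` with periods `(a, 0)` and `(0, b)`, such that
every backward step that fixes `x` multiplies `η` by a scalar. -/
structure IsPeriodicEigenvector (π : Rep θ H) (x : InfWord m n) (a b : ℕ) (η : H) : Prop where
  mem : η ∈ wordSpace π x
  norm_eq : ‖η‖ = 1
  a_pos : 0 < a
  b_pos : 0 < b
  shift_a : x.shift a 0 = x
  shift_b : x.shift 0 b = x
  eigen : ∀ s t, x.shift s t = x → ∃ c : ℂ, shiftOp π s t η = c • η

/-- The unit vectors that are labelled by some infinite word and that meet the backward orbit of `η`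
up to a scalar. -/
def orbitVectors (π : Rep θ H) (η : H) : Set H :=
  {v | ‖v‖ = 1 ∧ (∃ y, v ∈ wordSpace π y) ∧
    ∃ (s t s' t' : ℕ) (c : ℂ), shiftOp π s t v = c • shiftOp π s' t' η}

/-- The closed span of the orbit vectors of `η`. -/
def orbitSpace (π : Rep θ H) (η : H) : Submodule ℂ H :=
  (Submodule.span ℂ (orbitVectors π η)).topologicalClosure

variable {π : Rep θ H} {x y : InfWord m n} {a b : ℕ} {η v v' : H}

lemma subset_orbitSpace : orbitVectors π η ⊆ orbitSpace π η :=
  Submodule.subset_span.trans (Submodule.le_topologicalClosure _)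

lemma eq_zero_of_inner_orbitVectors (hv : v ∈ orbitSpace π η)
    (h : ∀ u ∈ orbitVectors π η, ⟪u, v⟫_ℂ = 0) : v = 0 := by
  have h1 : orbitSpace π η ≤ (ℂ ∙ v)ᗮ := by
    refine Submodule.topologicalClosure_minimal _ (Submodule.span_le.2 fun u hu => ?_)
      (Submodule.isClosed_orthogonal _)
    exact Submodule.mem_orthogonal_singleton_iff_inner_left.2 (h u hu)
  exact inner_self_eq_zero.1 (Submodule.mem_orthogonal_singleton_iff_inner_left.1 (h1 hv))

lemma InfWord.shift_mul (ha : x.shift a 0 = x) (hb : x.shift 0 b = x) (s t : ℕ) :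
    x.shift (s * a) (t * b) = x := by
  have h1 : ∀ t, x.shift 0 (t * b) = x := by
    intro t
    induction t with
    | zero => rw [zero_mul]; rfl
    | succ t ih =>
      have := InfWord.shift_shift 0 (t * b) 0 b x
      rw [hb, ih] at this
      rw [add_mul, one_mul]
      exact this.symm
  induction s with
  | zero => rw [zero_mul, h1]
  | succ s ih =>
    have := InfWord.shift_shift (s * a) (t * b) a 0 x
    rw [ha, ih] at this
    rw [add_mul, one_mul]
    exact this.symm

omit [CompleteSpace H] in
lemma norm_eq_one_of_smul {c : ℂ} (hv : ‖v‖ = 1) (h : ‖c • v‖ = 1) : ‖c‖ = 1 := by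
  rwa [norm_smul, hv, mul_one] at h

section Star

variable (hπ : IsStarRep π)
include hπ

/-- Positions of the backward orbit of `η` carrying the same word carry parallel vectors: further
backward steps return both positions to the word of `η`, where the eigenvector property applies. -/
lemma IsPeriodicEigenvector.exists_smul (hη : IsPeriodicEigenvector π x a b η)
    {s t s' t' : ℕ} (h : x.shift s t = x.shift s' t') :
    ∃ c : ℂ, ‖c‖ = 1 ∧ shiftOp π s t η = c • shiftOp π s' t' η := by
  -- `A` and `B` complete `(s, t)` to a pair of multiples of the periods.
  obtain ⟨A, hA⟩ : ∃ A, A + s = s * a :=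
    ⟨s * a - s, Nat.sub_add_cancel (Nat.le_mul_of_pos_right _ hη.a_pos)⟩
  obtain ⟨B, hB⟩ : ∃ B, B + t = t * b :=
    ⟨t * b - t, Nat.sub_add_cancel (Nat.le_mul_of_pos_right _ hη.b_pos)⟩
  have h1 : x.shift (A + s) (B + t) = x := by
    rw [hA, hB, InfWord.shift_mul hη.shift_a hη.shift_b]
  have h2 : x.shift (A + s') (B + t') = x := by
    rw [← InfWord.shift_shift, ← h, InfWord.shift_shift, h1]
  obtain ⟨c, hc⟩ := hη.eigen _ _ h1
  obtain ⟨d, hd⟩ := hη.eigen _ _ h2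
  have hc1 : ‖c‖ = 1 := norm_eq_one_of_smul hη.norm_eq <| by
    rw [← hc, norm_shiftOp hπ _ _ hη.mem, hη.norm_eq]
  have hd1 : ‖d‖ = 1 := norm_eq_one_of_smul hη.norm_eq <| by
    rw [← hd, norm_shiftOp hπ _ _ hη.mem, hη.norm_eq]
  have hd0 : d ≠ 0 := fun h => by simp [h] at hd1
  refine ⟨c / d, by rw [norm_div, hc1, hd1, div_one], ?_⟩
  refine eq_of_shiftOp_eq hπ A B (shiftOp_mem_wordSpace s t hη.mem)
    (Submodule.smul_mem _ _ (h ▸ shiftOp_mem_wordSpace s' t' hη.mem)) ?_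
  rw [map_smul, shiftOp_shiftOp, shiftOp_shiftOp, hc, hd, smul_smul, div_mul_cancel₀ _ hd0]

lemma norm_map_eq_one (hv : ‖v‖ = 1) (w : FTheta θ) : ‖π w v‖ = 1 := by rw [hπ.1, hv]

lemma downE_mem_orbitVectors (hv : v ∈ orbitVectors π η) : downE π v ∈ orbitVectors π η := by
  obtain ⟨h1, ⟨y, hy⟩, s, t, s', t', c, h⟩ := hv
  rw [downE_eq_shiftOp]
  refine ⟨by rw [norm_shiftOp hπ _ _ hy, h1], ⟨_, shiftOp_mem_wordSpace 1 0 hy⟩,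
    s, t, 1 + s', 0 + t', c, ?_⟩
  rw [shiftOp_comm, h, map_smul, shiftOp_shiftOp]

lemma downF_mem_orbitVectors (hv : v ∈ orbitVectors π η) : downF π v ∈ orbitVectors π η := by
  obtain ⟨h1, ⟨y, hy⟩, s, t, s', t', c, h⟩ := hv
  rw [downF_eq_shiftOp]
  refine ⟨by rw [norm_shiftOp hπ _ _ hy, h1], ⟨_, shiftOp_mem_wordSpace 0 1 hy⟩,
    s, t, 0 + s', 1 + t', c, ?_⟩
  rw [shiftOp_comm, h, map_smul, shiftOp_shiftOp]

lemma map_e_mem_orbitVectors (hv : v ∈ orbitVectors π η) (i : Fin m) :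
    π (e θ i) v ∈ orbitVectors π η := by
  obtain ⟨h1, ⟨y, hy⟩, s, t, s', t', c, h⟩ := hv
  refine ⟨norm_map_eq_one hπ h1 _, exists_word_map_e hπ hy i, s + 1, t + 0, s', t', c, ?_⟩
  rw [← shiftOp_shiftOp, ← downE_eq_shiftOp, downE_map_e hπ, h]

lemma map_f_mem_orbitVectors (hv : v ∈ orbitVectors π η) (j : Fin n) :
    π (f θ j) v ∈ orbitVectors π η := by
  obtain ⟨h1, ⟨y, hy⟩, s, t, s', t', c, h⟩ := hv
  refine ⟨norm_map_eq_one hπ h1 _, exists_word_map_f hπ hy j, s + 0, t + 1, s', t', c, ?_⟩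
  rw [← shiftOp_shiftOp, ← downF_eq_shiftOp, downF_map_f hπ, h]

lemma map_mem_orbitVectors (hv : v ∈ orbitVectors π η) (w : FTheta θ) :
    π w v ∈ orbitVectors π η := by
  induction w using FTheta.induction with
  | one => simpa using hv
  | e_mul i w ih => rw [map_mul]; exact map_e_mem_orbitVectors hπ ih i
  | f_mul j w ih => rw [map_mul]; exact map_f_mem_orbitVectors hπ ih j

lemma adjoint_e_mem_span (hv : v ∈ orbitVectors π η) (i : Fin m) :
    adjoint (π (e θ i)) v ∈ Submodule.span ℂ (orbitVectors π η) := by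
  obtain ⟨y, hy⟩ := hv.2.1
  have h := map_e_downE hy
  by_cases hi : i = (y 0 0).1
  · rw [hi, hπ.cuntz_e.adjoint_apply_eq h]
    exact Submodule.subset_span (downE_mem_orbitVectors hπ hv)
  · rw [hπ.cuntz_e.adjoint_apply_eq_zero hi h]
    exact zero_mem _

lemma adjoint_f_mem_span (hv : v ∈ orbitVectors π η) (j : Fin n) :
    adjoint (π (f θ j)) v ∈ Submodule.span ℂ (orbitVectors π η) := by
  obtain ⟨y, hy⟩ := hv.2.1
  have h := map_f_downF hy
  by_cases hj : j = (y 0 0).2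
  · rw [hj, hπ.cuntz_f.adjoint_apply_eq h]
    exact Submodule.subset_span (downF_mem_orbitVectors hπ hv)
  · rw [hπ.cuntz_f.adjoint_apply_eq_zero hj h]
    exact zero_mem _

lemma isReducing_orbitSpace : IsReducing π (orbitSpace π η) :=
  isReducing_topologicalClosure_span
    (fun i _ hv => Submodule.subset_span (map_e_mem_orbitVectors hπ hv i))
    (fun j _ hv => Submodule.subset_span (map_f_mem_orbitVectors hπ hv j))
    (fun i _ hv => adjoint_e_mem_span hπ hv i) (fun j _ hv => adjoint_f_mem_span hπ hv j)

/-- A reducing subspace containing `η` contains every orbit vector `v`: the projection of `v` has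
the same word and the same distant past as `v`, hence equals `v`. -/
lemma orbitSpace_le {N : Submodule ℂ H} (hN : IsReducing π N) (hη : η ∈ N) :
    orbitSpace π η ≤ N := by
  have := hN.hasOrthogonalProjection
  have hR := hN.intertwining
  refine Submodule.topologicalClosure_minimal _ (Submodule.span_le.2 fun v hv => ?_) hN.isClosed
  obtain ⟨-, ⟨y, hy⟩, s, t, s', t', c, h⟩ := hv
  refine Submodule.starProjection_eq_self_iff.1
    (eq_of_shiftOp_eq hπ s t (hR.mem_wordSpace hy) hy ?_)
  rw [← hR.shiftOp_comm, h, map_smul, hR.shiftOp_comm, Submodule.starProjection_eq_self_iff.2 hη]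

variable (hη : IsPeriodicEigenvector π x a b η)
include hη

lemma shiftOp_mem_orbitVectors (s t : ℕ) : shiftOp π s t η ∈ orbitVectors π η :=
  ⟨by rw [norm_shiftOp hπ _ _ hη.mem, hη.norm_eq], ⟨_, shiftOp_mem_wordSpace s t hη.mem⟩,
    0, 0, s, t, 1, by rw [shiftOp_zero, one_smul]⟩

lemma self_mem_orbitVectors : η ∈ orbitVectors π η := by
  simpa [shiftOp_zero] using shiftOp_mem_orbitVectors hπ hη 0 0

/-- Orbit vectors labelled by the same infinite word are parallel. -/
lemma exists_smul_of_mem_orbitVectors (hv : v ∈ orbitVectors π η) (hv' : v' ∈ orbitVectors π η)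
    (hy : v ∈ wordSpace π y) (hy' : v' ∈ wordSpace π y) : ∃ c : ℂ, ‖c‖ = 1 ∧ v = c • v' := by
  obtain ⟨h1, -, s, t, s', t', c, h⟩ := hv
  obtain ⟨h1', -, p, q, p', q', d, h'⟩ := hv'
  have e1 : shiftOp π (p + s) (q + t) v = c • shiftOp π (p + s') (q + t') η := by
    rw [← shiftOp_shiftOp, h, map_smul, shiftOp_shiftOp]
  have e2 : shiftOp π (p + s) (q + t) v' = d • shiftOp π (s + p') (t + q') η := by
    rw [add_comm p, add_comm q, ← shiftOp_shiftOp, h', map_smul, shiftOp_shiftOp]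
  have hn : ∀ {u : H} {c : ℂ} {k l : ℕ}, u ∈ wordSpace π y → ‖u‖ = 1 →
      shiftOp π (p + s) (q + t) u = c • shiftOp π k l η →
      ‖c‖ = 1 ∧ y.shift (p + s) (q + t) = x.shift k l := by
    intro u c k l hu hu1 hc
    have h2 : ‖c • shiftOp π k l η‖ = 1 := by rw [← hc, norm_shiftOp hπ _ _ hu, hu1]
    refine ⟨norm_eq_one_of_smul (shiftOp_mem_orbitVectors hπ hη k l).1 h2, ?_⟩
    refine word_unique hπ (shiftOp_mem_wordSpace _ _ hu) ?_ fun h0 => ?_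
    · rw [hc]
      exact Submodule.smul_mem _ _ (shiftOp_mem_wordSpace _ _ hη.mem)
    · rw [← hc, h0, norm_zero] at h2
      exact zero_ne_one h2
  obtain ⟨hc, hx⟩ := hn hy h1 e1
  obtain ⟨hd, hx'⟩ := hn hy' h1' e2
  obtain ⟨k, hk, hk'⟩ := hη.exists_smul hπ (hx.symm.trans hx')
  have hd0 : d ≠ 0 := fun h => by simp [h] at hd
  refine ⟨c * k / d, by simp [hc, hk, hd], ?_⟩
  refine eq_of_shiftOp_eq hπ (p + s) (q + t) hy (Submodule.smul_mem _ _ hy') ?_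
  rw [map_smul, e1, e2, hk', smul_smul, smul_smul, div_mul_cancel₀ _ hd0]

/-- The projection onto a reducing subspace maps `η` to a vector labelled by the same word; in the
orbit space such vectors are the multiples of `η`. -/
lemma eq_bot_or_eq_orbitSpace {M : Submodule ℂ H} (hM : IsReducing π M)
    (hle : M ≤ orbitSpace π η) : M = ⊥ ∨ M = orbitSpace π η := by
  have := hM.hasOrthogonalProjection
  have hR := hM.intertwining
  have hηB := self_mem_orbitVectors hπ hη
  obtain ⟨c, hc⟩ : ∃ c : ℂ, M.starProjection η = c • η := by
    refine ⟨⟪η, M.starProjection η⟫_ℂ, sub_eq_zero.1 ?_⟩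
    set c := ⟪η, M.starProjection η⟫_ℂ with hcdef
    refine eq_zero_of_inner_orbitVectors (η := η) (π := π)
      (sub_mem (hle (M.starProjection_apply_mem η))
        (Submodule.smul_mem _ _ (subset_orbitSpace hηB))) fun u hu => ?_
    have hw : M.starProjection η - c • η ∈ wordSpace π x :=
      sub_mem (hR.mem_wordSpace hη.mem) (Submodule.smul_mem _ _ hη.mem)
    obtain ⟨y, hy⟩ := hu.2.1
    by_cases hxy : y = x
    · subst hxy
      obtain ⟨d, -, hd⟩ := exists_smul_of_mem_orbitVectors hπ hη hu hηB hy hη.mem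
      have h1 : ⟪η, η⟫_ℂ = 1 := by rw [inner_self_eq_norm_sq_to_K, hη.norm_eq]; simp
      rw [hd, inner_smul_left, inner_sub_right, inner_smul_right, h1, ← hcdef]
      simp
    · exact inner_eq_zero_of_word_ne hπ hxy hy hw
  by_cases hc0 : c = 0
  · left
    have h1 : η ∈ Mᗮ := by
      rw [hc0, zero_smul] at hc
      exact (Submodule.starProjection_apply_eq_zero_iff M).1 hc
    have h2 := hle.trans (orbitSpace_le hπ hM.orthogonal h1)
    rw [eq_bot_iff]
    intro z hz
    exact inner_self_eq_zero.1 ((M.mem_orthogonal _).1 (h2 hz) z hz)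
  · right
    refine le_antisymm hle (orbitSpace_le hπ hM ?_)
    have h1 : η = c⁻¹ • M.starProjection η := by rw [hc, smul_smul, inv_mul_cancel₀ hc0, one_smul]
    rw [h1]
    exact Submodule.smul_mem _ _ (M.starProjection_apply_mem η)

end Star

end Orbit

/-! ### Restriction to a reducing subspace -/

section Restrict

variable {m n : ℕ} {θ : Equiv.Perm (Fin m × Fin n)}
  {H : Type u} [NormedAddCommGroup H] [InnerProductSpace ℂ H] [CompleteSpace H]
  {π : Rep θ H} {M : Submodule ℂ H}

/-- The restriction of a representation to a reducing subspace. -/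
noncomputable def restrictRep (hM : IsReducing π M) : Rep θ M where
  toFun w := (π w ∘L M.subtypeL).codRestrict M fun x => hM.map_mem w x x.2
  map_one' := by ext x; simp
  map_mul' w w' := by
    ext x
    change π (w * w') x = π w (π w' x)
    rw [map_mul]
    rfl

@[simp]
lemma coe_restrictRep (hM : IsReducing π M) (w : FTheta θ) (x : M) :
    (restrictRep hM w x : H) = π w x := rfl

@[simp]
lemma coe_adjoint_restrictRep [CompleteSpace M] (hM : IsReducing π M) (w : FTheta θ) (x : M) :
    (adjoint (restrictRep hM w) x : H) = adjoint (π w) x := by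
  have h : adjoint (restrictRep hM w) x = ⟨adjoint (π w) x, hM.coinvariant w x x.2⟩ := by
    refine ext_inner_right ℂ fun y => ?_
    rw [adjoint_inner_left, Submodule.coe_inner, Submodule.coe_inner, coe_restrictRep,
      adjoint_inner_left]
  rw [h]

lemma isStarRep_restrictRep [CompleteSpace M] (hπ : IsStarRep π) (hM : IsReducing π M) :
    IsStarRep (restrictRep hM) := by
  refine ⟨fun w x => hπ.1 w x, ?_, ?_⟩
  · ext x
    simpa [_root_.sum_apply] using hπ.cuntz_e.sum_apply (x : H)
  · ext x
    simpa [_root_.sum_apply] using hπ.cuntz_f.sum_apply (x : H)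

lemma IsIsometric.isPartiallyIsometric (hπ : IsIsometric π) : IsPartiallyIsometric π := by
  intro w
  ext x
  simp [adjoint_apply_of_isometry (hπ w)]

lemma coe_downE_restrictRep [CompleteSpace M] (hM : IsReducing π M) (z : M) :
    (downE (restrictRep hM) z : H) = downE π z := by
  simp [downE, down, _root_.sum_apply]

lemma coe_downF_restrictRep [CompleteSpace M] (hM : IsReducing π M) (z : M) :
    (downF (restrictRep hM) z : H) = downF π z := by
  simp [downF, down, _root_.sum_apply]

lemma coe_shiftOp_restrictRep [CompleteSpace M] (hM : IsReducing π M) (s t : ℕ) (z : M) :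
    (shiftOp (restrictRep hM) s t z : H) = shiftOp π s t z := by
  induction s with
  | zero =>
    induction t with
    | zero => simp [shiftOp_zero]
    | succ t ih => rw [← downF_shiftOp, coe_downF_restrictRep, ih, downF_shiftOp]
  | succ s ih => rw [← downE_shiftOp, coe_downE_restrictRep, ih, downE_shiftOp]

lemma mem_wordSpace_restrictRep [CompleteSpace M] (hM : IsReducing π M) {x : InfWord m n} {z : M} :
    z ∈ wordSpace (restrictRep hM) x ↔ (z : H) ∈ wordSpace π x := by
  refine forall₂_congr fun s t => ?_
  simp only [Subtype.ext_iff, coe_restrictRep, coe_downE_restrictRep, coe_downF_restrictRep,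
    coe_shiftOp_restrictRep]

variable {x : InfWord m n} {a b : ℕ} {η : H}

lemma isIrreducible_restrictRep_orbitSpace (hπ : IsStarRep π)
    (hη : IsPeriodicEigenvector π x a b η) [CompleteSpace (orbitSpace π η)] :
    IsIrreducible (restrictRep (isReducing_orbitSpace (η := η) hπ)) := by
  have hηB := self_mem_orbitVectors hπ hη
  refine ⟨⟨⟨η, subset_orbitSpace hηB⟩, 0, fun h => ?_⟩, fun M hM hmap hco => ?_⟩
  · have h1 : η = 0 := congrArg Subtype.val h
    simpa [h1] using hη.norm_eq
  · have hred : IsReducing π (M.map (orbitSpace π η).subtype) := by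
      refine ⟨?_, ?_, ?_⟩
      · exact (isReducing_orbitSpace hπ).isClosed.isClosedEmbedding_subtypeVal.isClosedMap _ hM
      · rintro w _ ⟨z, hz, rfl⟩
        exact ⟨_, hmap w z hz, rfl⟩
      · rintro w _ ⟨z, hz, rfl⟩
        exact ⟨_, hco w z hz, by simp⟩
    rcases eq_bot_or_eq_orbitSpace hπ hη hred (Submodule.map_subtype_le _ _) with h | h
    · left
      rw [eq_bot_iff]
      intro z hz
      have : (z : H) ∈ M.map (orbitSpace π η).subtype := ⟨z, hz, rfl⟩
      rw [h] at this
      exact Subtype.ext this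
    · right
      rw [eq_top_iff]
      intro z _
      obtain ⟨z', hz', h'⟩ : (z : H) ∈ M.map (orbitSpace π η).subtype := by
        rw [h]
        exact z.2
      rwa [← Subtype.ext h']

/-- An orthonormal basis is obtained by choosing one orbit vector for each infinite word that labels
an orbit vector. -/
lemma isAtomic_restrictRep_orbitSpace (hπ : IsStarRep π)
    (hη : IsPeriodicEigenvector π x a b η) [CompleteSpace (orbitSpace π η)] :
    IsAtomic (restrictRep (isReducing_orbitSpace (η := η) hπ)) := by
  refine ⟨(isStarRep_restrictRep hπ _).1.isPartiallyIsometric, ?_⟩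
  let κ := ULift.{u} {y : InfWord m n // ∃ v ∈ orbitVectors π η, v ∈ wordSpace π y}
  choose u hu huw using fun k : κ => k.down.2
  let ξ : κ → orbitSpace π η := fun k => ⟨u k, subset_orbitSpace (hu k)⟩
  have hξ : Orthonormal ℂ ξ := by
    refine ⟨fun k => (hu k).1, fun k l hkl => ?_⟩
    change ⟪u k, u l⟫_ℂ = 0
    exact inner_eq_zero_of_word_ne hπ
      (fun h => hkl (ULift.ext _ _ (Subtype.ext h))) (huw k) (huw l)
  have hpar : ∀ v ∈ orbitVectors π η, ∃ (k : κ) (c : ℂ), ‖c‖ = 1 ∧ v = c • u k := by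
    intro v hv
    obtain ⟨y, hy⟩ := hv.2.1
    let k : κ := ⟨⟨y, v, hv, hy⟩⟩
    exact ⟨k, exists_smul_of_mem_orbitVectors hπ hη hv (hu k) hy (huw k)⟩
  have hbot : (Submodule.span ℂ (Set.range ξ))ᗮ = ⊥ := by
    rw [eq_bot_iff]
    intro z hz
    refine Subtype.ext (eq_zero_of_inner_orbitVectors z.2 fun v hv => ?_)
    obtain ⟨k, c, -, rfl⟩ := hpar v hv
    have h1 : ⟪ξ k, z⟫_ℂ = 0 :=
      (Submodule.mem_orthogonal _ _).1 hz _ (Submodule.subset_span ⟨k, rfl⟩)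
    rw [inner_smul_left]
    exact mul_eq_zero_of_right _ h1
  refine ⟨κ, HilbertBasis.mkOfOrthogonalEqBot hξ hbot, fun w k => ?_⟩
  obtain ⟨l, c, hc, h⟩ := hpar _ (map_mem_orbitVectors hπ (hu k) w)
  refine ⟨l, c, Or.inl hc, ?_⟩
  rw [HilbertBasis.coe_mkOfOrthogonalEqBot]
  exact Subtype.ext h

end Restrict

/-! ### Compression to a group construction representation -/

section Compression

variable {m n : ℕ} {θ : Equiv.Perm (Fin m × Fin n)}
  {H : Type*} [NormedAddCommGroup H] [InnerProductSpace ℂ H] [CompleteSpace H]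

lemma IsCuntzFamily.eq_of_map_eq {ι : Type*} [Fintype ι] {S : ι → H →L[ℂ] H}
    (hS : IsCuntzFamily S) {i j : ι} {x y : H} (hx : x ≠ 0) (h : S i x = S j y) :
    i = j ∧ x = y := by
  have h1 : i = j := by
    by_contra hij
    apply hx
    rw [← hS.adjoint_apply_self i x, h, hS.adjoint_apply_of_ne hij]
  subst h1
  exact ⟨rfl, by rw [← hS.adjoint_apply_self i x, h, hS.adjoint_apply_self]⟩

/-- The compression of `π` along an isometry `V`, which is multiplicative because the range of `V`
is coinvariant. -/
noncomputable def compression {L : Type*} [NormedAddCommGroup L] [InnerProductSpace ℂ L]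
    [CompleteSpace L] (π : Rep θ H) (V : L →ₗᵢ[ℂ] H)
    (hV : ∀ w x, ∃ z, adjoint (π w) (V x) = V z) : Rep θ L where
  toFun w := adjoint V.toContinuousLinearMap ∘L π w ∘L V.toContinuousLinearMap
  map_one' := by
    ext x
    refine ext_inner_left ℂ fun y => ?_
    simp [adjoint_inner_right]
  map_mul' w w' := by
    ext x
    refine ext_inner_left ℂ fun y => ?_
    obtain ⟨z, hz⟩ := hV w y
    simp only [ContinuousLinearMap.comp_apply, ContinuousLinearMap.mul_def, map_mul,
      adjoint_inner_right, LinearIsometry.coe_toContinuousLinearMap]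
    rw [← adjoint_inner_left, ← adjoint_inner_left (π w), hz, LinearIsometry.inner_map_map,
      adjoint_inner_right, LinearIsometry.coe_toContinuousLinearMap]

lemma eq_sum_stdVec {G : Type*} [Fintype G] (x : lp (fun _ : G => ℂ) 2) :
    x = ∑ g, x g • stdVec g := by
  classical
  have h := lp.hasSum_single (E := fun _ : G => ℂ) (p := 2) (by simp) x
  have h0 : x = ∑ g, lp.single 2 g (x g) := h.unique (hasSum_fintype _)
  refine h0.trans (Finset.sum_congr rfl fun g _ => ?_)
  have h1 : (lp.single 2 g (x g) : lp (fun _ : G => ℂ) 2) = x g • lp.single 2 g (1 : ℂ) := by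
    rw [← lp.single_smul, smul_eq_mul, mul_one]
  rw [h1, stdVec]

/-- Unit vectors `v g` labelled by pairwise different infinite words and permuted, up to scalars, by
the backward steps as by translations of `G` span a coinvariant subspace, on which the compression
is a group construction representation. -/
lemma exists_groupConstruction {π : Rep θ H} (hπ : IsStarRep π) {G : Type} [AddCommGroup G]
    [Finite G] (g₁ g₂ : G) (hgen : AddSubgroup.closure {g₁, g₂} = (⊤ : AddSubgroup G))
    {y : G → InfWord m n} (hy : Function.Injective y) {v : G → H}
    (hv : ∀ g, v g ∈ wordSpace π (y g)) (hnorm : ∀ g, ‖v g‖ = 1)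
    (hE : ∀ g, ∃ c : ℂ, ‖c‖ = 1 ∧ downE π (v (g + g₁)) = c • v g)
    (hF : ∀ g, ∃ c : ℂ, ‖c‖ = 1 ∧ downF π (v (g + g₂)) = c • v g) :
    ∃ σ : Rep θ (lp (fun _ : G => ℂ) 2), IsGroupConstruction σ ∧ IsDilation π σ := by
  classical
  have := Fintype.ofFinite G
  have hv0 : ∀ g, v g ≠ 0 := fun g h => by simpa [h] using hnorm g
  have horth : Orthonormal ℂ v :=
    ⟨hnorm, fun g h hgh => inner_eq_zero_of_word_ne hπ (fun e => hgh (hy e)) (hv g) (hv h)⟩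
  let i : G → Fin m := fun g => (y (g + g₁) 0 0).1
  let j : G → Fin n := fun g => (y (g + g₂) 0 0).2
  have hEi : ∀ g, π (e θ (i g)) (downE π (v (g + g₁))) = v (g + g₁) := fun g => map_e_downE (hv _)
  have hFj : ∀ g, π (f θ (j g)) (downF π (v (g + g₂))) = v (g + g₂) := fun g => map_f_downF (hv _)
  have hα : ∀ g, ∃ α : Circle, π (e θ (i g)) (v g) = (α : ℂ) • v (g + g₁) := by
    intro g
    obtain ⟨c, hc, h⟩ := hE g
    have hc0 : c ≠ 0 := fun h => by simp [h] at hc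
    refine ⟨⟨c⁻¹, mem_sphere_zero_iff_norm.2 (by rw [norm_inv, hc, inv_one])⟩, ?_⟩
    change _ = c⁻¹ • v (g + g₁)
    rw [← hEi g, h, map_smul, smul_smul, inv_mul_cancel₀ hc0, one_smul]
  have hβ : ∀ g, ∃ β : Circle, π (f θ (j g)) (v g) = (β : ℂ) • v (g + g₂) := by
    intro g
    obtain ⟨c, hc, h⟩ := hF g
    have hc0 : c ≠ 0 := fun h => by simp [h] at hc
    refine ⟨⟨c⁻¹, mem_sphere_zero_iff_norm.2 (by rw [norm_inv, hc, inv_one])⟩, ?_⟩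
    change _ = c⁻¹ • v (g + g₂)
    rw [← hFj g, h, map_smul, smul_smul, inv_mul_cancel₀ hc0, one_smul]
  choose α hα using hα
  choose β hβ using hβ
  have hef : ∀ g, π (e θ (i (g + g₂))) (π (f θ (j g)) (v g)) =
      ((α (g + g₂) : ℂ) * β g) • v (g + g₁ + g₂) := by
    intro g
    rw [hβ, map_smul, hα, smul_smul, mul_comm, add_right_comm]
  have hfe : ∀ g, π (f θ (j (g + g₁))) (π (e θ (i g)) (v g)) =
      ((β (g + g₁) : ℂ) * α g) • v (g + g₁ + g₂) := by
    intro g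
    rw [hα, map_smul, hβ, smul_smul, mul_comm]
  -- The labels on the two sides of the commuting square are determined by the vector
  -- `v (g + g₁ + g₂)`, which lies in the range of only one `π(f_j)` and, one step back, of only one
  -- `π(e_i)`.
  have hword : ∀ g, e θ (i (g + g₂)) * f θ (j g) = f θ (j (g + g₁)) * e θ (i g) := by
    intro g
    have h1 := hef g
    rw [map_e_map_f] at h1
    set p := θ (i (g + g₂), j g) with hp
    set c : ℂ := ((α (g + g₂) : ℂ) * β g) / ((β (g + g₁) : ℂ) * α g) with hc
    have hd : ((β (g + g₁) : ℂ) * α g) ≠ 0 :=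
      mul_ne_zero (Circle.coe_ne_zero _) (Circle.coe_ne_zero _)
    have h2 : π (f θ p.2) (π (e θ p.1) (v g)) = π (f θ (j (g + g₁))) (π (e θ (i g)) (c • v g)) := by
      rw [h1, map_smul, map_smul, hfe, smul_smul, hc, div_mul_cancel₀ _ hd]
    obtain ⟨hj, h3⟩ := hπ.cuntz_f.eq_of_map_eq (fun h => hv0 g <| by
      rw [← norm_eq_zero, ← hπ.1 (e θ p.1), h, norm_zero]) h2
    obtain ⟨hi, -⟩ := hπ.cuntz_e.eq_of_map_eq (hv0 g) h3
    rw [e_mul_f, ← hp, hi, hj]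
  have hscalar : ∀ g, α (g + g₂) * β g = β (g + g₁) * α g := by
    intro g
    have h1 : π (e θ (i (g + g₂)) * f θ (j g)) (v g) = π (f θ (j (g + g₁)) * e θ (i g)) (v g) := by
      rw [hword]
    simp only [map_mul, mul_apply_eq_comp] at h1
    rw [hef, hfe] at h1
    exact Circle.ext (by simpa using smul_left_injective ℂ (hv0 _) h1)
  have hE0 : ∀ i' g, i' ≠ i g → ∀ h, ⟪v h, π (e θ i') (v g)⟫_ℂ = 0 := by
    intro i' g hi h
    obtain ⟨h, rfl⟩ : ∃ h', h = h' + g₁ := ⟨h - g₁, by simp⟩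
    rw [← adjoint_inner_left]
    by_cases hi' : i' = i h
    · obtain ⟨c, -, hc⟩ := hE h
      rw [hi', hπ.cuntz_e.adjoint_apply_eq (hEi h)]
      change ⟪downE π _, _⟫_ℂ = 0
      rw [hc, inner_smul_left, horth.2 (fun hgh : h = g => hi (hgh ▸ hi')), mul_zero]
    · rw [hπ.cuntz_e.adjoint_apply_eq_zero hi' (hEi h), inner_zero_left]
  have hF0 : ∀ j' g, j' ≠ j g → ∀ h, ⟪v h, π (f θ j') (v g)⟫_ℂ = 0 := by
    intro j' g hj h
    obtain ⟨h, rfl⟩ : ∃ h', h = h' + g₂ := ⟨h - g₂, by simp⟩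
    rw [← adjoint_inner_left]
    by_cases hj' : j' = j h
    · obtain ⟨c, -, hc⟩ := hF h
      rw [hj', hπ.cuntz_f.adjoint_apply_eq (hFj h)]
      change ⟪downF π _, _⟫_ℂ = 0
      rw [hc, inner_smul_left, horth.2 (fun hgh : h = g => hj (hgh ▸ hj')), mul_zero]
    · rw [hπ.cuntz_f.adjoint_apply_eq_zero hj' (hFj h), inner_zero_left]
  let V : lp (fun _ : G => ℂ) 2 →ₗᵢ[ℂ] H := horth.orthogonalFamily.linearIsometry
  have hV : ∀ g, V (stdVec g) = v g := by
    intro g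
    have h1 : (stdVec g : lp (fun _ : G => ℂ) 2) = lp.single 2 g (1 : ℂ) := by
      rw [stdVec]
    rw [h1]
    exact (horth.orthogonalFamily.linearIsometry_apply_single _).trans (by simp)
  have hVsum : ∀ x, V x = ∑ g, x g • v g := by
    intro x
    conv_lhs => rw [eq_sum_stdVec x, map_sum]
    simp [hV]
  have hspan : ∀ u, u ∈ LinearMap.range V.toLinearMap ↔ u ∈ Submodule.span ℂ (Set.range v) := by
    refine fun u => ⟨?_, ?_⟩
    · rintro ⟨x, rfl⟩
      change V x ∈ _
      rw [hVsum]
      exact sum_mem fun g _ => Submodule.smul_mem _ _ (Submodule.subset_span ⟨g, rfl⟩)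
    · refine fun hu => (Submodule.span_le.2 ?_) hu
      rintro _ ⟨g, rfl⟩
      exact ⟨stdVec g, hV g⟩
  have hco : ∀ w, ∀ u ∈ Submodule.span ℂ (Set.range v),
      adjoint (π w) u ∈ Submodule.span ℂ (Set.range v) := by
    have key : ∀ T : H →L[ℂ] H, (∀ g, T (v g) ∈ Submodule.span ℂ (Set.range v)) →
        ∀ u ∈ Submodule.span ℂ (Set.range v), T u ∈ Submodule.span ℂ (Set.range v) := by
      intro T hT u hu
      refine (Submodule.span_le (p := (Submodule.span ℂ (Set.range v)).comap T.toLinearMap)).2 ?_ hu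
      rintro _ ⟨g, rfl⟩
      exact hT g
    intro w
    induction w using FTheta.induction with
    | one =>
      intro u hu
      rw [map_one, ← ContinuousLinearMap.star_eq_adjoint, star_one]
      exact hu
    | e_mul i' w ih =>
      intro u hu
      rw [map_mul, ContinuousLinearMap.mul_def, ContinuousLinearMap.adjoint_comp]
      refine ih _ (key _ (fun g => ?_) u hu)
      obtain ⟨g, rfl⟩ : ∃ g', g = g' + g₁ := ⟨g - g₁, by simp⟩
      by_cases hi : i' = i g
      · obtain ⟨c, -, hc⟩ := hE g
        rw [hi, hπ.cuntz_e.adjoint_apply_eq (hEi g)]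
        change downE π _ ∈ _
        rw [hc]
        exact Submodule.smul_mem _ _ (Submodule.subset_span ⟨g, rfl⟩)
      · rw [hπ.cuntz_e.adjoint_apply_eq_zero hi (hEi g)]
        exact zero_mem _
    | f_mul j' w ih =>
      intro u hu
      rw [map_mul, ContinuousLinearMap.mul_def, ContinuousLinearMap.adjoint_comp]
      refine ih _ (key _ (fun g => ?_) u hu)
      obtain ⟨g, rfl⟩ : ∃ g', g = g' + g₂ := ⟨g - g₂, by simp⟩
      by_cases hj : j' = j g
      · obtain ⟨c, -, hc⟩ := hF g
        rw [hj, hπ.cuntz_f.adjoint_apply_eq (hFj g)]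
        change downF π _ ∈ _
        rw [hc]
        exact Submodule.smul_mem _ _ (Submodule.subset_span ⟨g, rfl⟩)
      · rw [hπ.cuntz_f.adjoint_apply_eq_zero hj (hFj g)]
        exact zero_mem _
  have hco' : ∀ w x, ∃ z, adjoint (π w) (V x) = V z := by
    intro w x
    obtain ⟨z, hz⟩ := (hspan _).2 (hco w (V x) ((hspan _).1 ⟨x, rfl⟩))
    exact ⟨z, hz.symm⟩
  have hadj : ∀ g, adjoint V.toContinuousLinearMap (v g) = stdVec g := by
    intro g
    refine ext_inner_left ℂ fun x => ?_
    rw [adjoint_inner_right, LinearIsometry.coe_toContinuousLinearMap, ← hV,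
      LinearIsometry.inner_map_map]
  have hadj0 : ∀ u, (∀ h, ⟪v h, u⟫_ℂ = 0) → adjoint V.toContinuousLinearMap u = 0 := by
    intro u hu
    refine ext_inner_left ℂ fun x => ?_
    rw [adjoint_inner_right, LinearIsometry.coe_toContinuousLinearMap, hVsum, sum_inner]
    simp [inner_smul_left, hu]
  refine ⟨compression π V hco', ⟨⟨g₁, g₂, hgen, i, j, α, β, hword, hscalar⟩, fun g => ⟨?_, ?_⟩⟩,
    V, fun w => rfl⟩
  · intro i'
    change adjoint V.toContinuousLinearMap (π (e θ i') (V (stdVec g))) = _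
    rw [hV]
    split_ifs with hi
    · rw [hi]
      change adjoint V.toContinuousLinearMap (π (e θ (i g)) (v g)) = _
      rw [hα, map_smul, hadj]
    · exact hadj0 _ (hE0 i' g hi)
  · intro j'
    change adjoint V.toContinuousLinearMap (π (f θ j') (V (stdVec g))) = _
    rw [hV]
    split_ifs with hj
    · rw [hj]
      change adjoint V.toContinuousLinearMap (π (f θ (j g)) (v g)) = _
      rw [hβ, map_smul, hadj]
    · exact hadj0 _ (hF0 j' g hj)

end Compression

/-! ### The symmetry group of a doubly periodic word -/

section Torus

variable {m n : ℕ} {a b : ℕ}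

/-- The word seen from a position `g` of the torus of positions of a word with periods `(a, 0)` and
`(0, b)`. -/
def InfWord.torus (x : InfWord m n) (g : ZMod a × ZMod b) : InfWord m n :=
  x.shift g.1.val g.2.val

variable {x : InfWord m n} (ha : x.shift a 0 = x) (hb : x.shift 0 b = x)
include ha hb

lemma InfWord.shift_eq_torus (s t : ℕ) : x.shift s t = x.torus ((s, t) : ZMod a × ZMod b) := by
  rw [InfWord.torus, ZMod.val_natCast, ZMod.val_natCast]
  conv_rhs => rw [← InfWord.shift_mul ha hb (s / a) (t / b)]
  rw [InfWord.shift_shift, Nat.mod_add_div', Nat.mod_add_div']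

variable [NeZero a] [NeZero b]

lemma InfWord.shift_torus (s t : ℕ) (g : ZMod a × ZMod b) :
    (x.torus g).shift s t = x.torus (((s, t) : ZMod a × ZMod b) + g) := by
  rw [InfWord.torus, InfWord.shift_shift, InfWord.shift_eq_torus ha hb]
  congr 1
  ext <;> simp

omit [NeZero a] [NeZero b] in
lemma InfWord.torus_zero : x.torus (0 : ZMod a × ZMod b) = x := by
  have h := InfWord.shift_eq_torus ha hb 0 0
  simp only [Nat.cast_zero] at h
  exact h.symm

lemma InfWord.torus_add (g h : ZMod a × ZMod b) :
    x.torus (g + h) = (x.torus h).torus g := by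
  conv_rhs => rw [InfWord.torus, InfWord.shift_torus ha hb]
  simp

/-- The translations of the torus of positions that preserve the word. -/
def InfWord.symmetries : AddSubgroup (ZMod a × ZMod b) where
  carrier := {g | x.torus g = x}
  zero_mem' := InfWord.torus_zero ha hb
  add_mem' {g h} hg hh := by
    change x.torus (g + h) = x
    rw [InfWord.torus_add ha hb, hh, hg]
  neg_mem' {g} hg := by
    change x.torus (-g) = x
    conv_lhs => rw [← (show x.torus g = x from hg)]
    rw [← InfWord.torus_add ha hb, neg_add_cancel, InfWord.torus_zero ha hb]

lemma InfWord.torus_eq_torus_iff (g h : ZMod a × ZMod b) :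
    x.torus g = x.torus h ↔ (g : (ZMod a × ZMod b) ⧸ InfWord.symmetries ha hb) = h := by
  rw [QuotientAddGroup.eq]
  change _ ↔ x.torus (-g + h) = x
  rw [InfWord.torus_add ha hb]
  constructor
  · intro hgh
    rw [← hgh, ← InfWord.torus_add ha hb, neg_add_cancel, InfWord.torus_zero ha hb]
  · intro hgh
    have h1 := congrArg (fun z => z.torus g) hgh
    rw [← InfWord.torus_add ha hb, ← InfWord.torus_add ha hb, add_neg_cancel_left] at h1
    exact h1.symm

omit ha hb in
lemma closure_neg_generators (S : AddSubgroup (ZMod a × ZMod b)) :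
    AddSubgroup.closure {-(((1, 0) : ZMod a × ZMod b) : (ZMod a × ZMod b) ⧸ S),
      -(((0, 1) : ZMod a × ZMod b) : (ZMod a × ZMod b) ⧸ S)} = ⊤ := by
  rw [eq_top_iff]
  rintro γ -
  induction γ using QuotientAddGroup.induction_on with | H g
  have hg : g = g.1.val • ((1, 0) : ZMod a × ZMod b) + g.2.val • ((0, 1) : ZMod a × ZMod b) := by
    ext <;> simp
  rw [hg, QuotientAddGroup.mk_add, QuotientAddGroup.mk_nsmul, QuotientAddGroup.mk_nsmul]
  refine add_mem (nsmul_mem ?_ _) (nsmul_mem ?_ _)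
  · exact neg_mem_iff.1 (AddSubgroup.subset_closure (by simp))
  · exact neg_mem_iff.1 (AddSubgroup.subset_closure (by simp))

end Torus

section Dilation

variable {m n : ℕ} {θ : Equiv.Perm (Fin m × Fin n)}
  {H : Type u} [NormedAddCommGroup H] [InnerProductSpace ℂ H] [CompleteSpace H]
  {π : Rep θ H} {x : InfWord m n} {a b : ℕ} {η : H}

/-- The group is the torus of positions of the word of `η` modulo its symmetries, so that different
elements of the group see different words. -/
lemma exists_isDilation_restrictRep_orbitSpace (hπ : IsStarRep π)
    (hη : IsPeriodicEigenvector π x a b η) [CompleteSpace (orbitSpace π η)] :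
    ∃ (G : Type) (_ : AddCommGroup G) (_ : Finite G) (σ : Rep θ (lp (fun _ : G => ℂ) 2)),
      IsGroupConstruction σ ∧
        IsDilation (restrictRep (isReducing_orbitSpace (η := η) hπ)) σ := by
  have : NeZero a := ⟨hη.a_pos.ne'⟩
  have : NeZero b := ⟨hη.b_pos.ne'⟩
  have ha := hη.shift_a
  have hb := hη.shift_b
  let S := InfWord.symmetries ha hb
  let G := (ZMod a × ZMod b) ⧸ S
  let u : G → H := fun γ => shiftOp π γ.out.1.val γ.out.2.val η
  have hu : ∀ γ, u γ ∈ orbitVectors π η := fun γ => shiftOp_mem_orbitVectors hπ hη _ _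
  have huw : ∀ γ, u γ ∈ wordSpace π (x.torus γ.out) := fun γ => shiftOp_mem_wordSpace _ _ hη.mem
  have hinj : Function.Injective fun γ : G => x.torus γ.out := by
    intro γ δ h
    have h1 := (InfWord.torus_eq_torus_iff ha hb _ _).1 h
    rwa [QuotientAddGroup.out_eq', QuotientAddGroup.out_eq'] at h1
  have hstep : ∀ (γ : G) (g : ZMod a × ZMod b),
      x.torus (g + (γ + -(g : G)).out) = x.torus γ.out := by
    intro γ g
    rw [InfWord.torus_eq_torus_iff ha hb, QuotientAddGroup.mk_add, QuotientAddGroup.out_eq',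
      QuotientAddGroup.out_eq']
    abel
  refine ⟨G, inferInstance, inferInstance, ?_⟩
  refine exists_groupConstruction (isStarRep_restrictRep hπ _) _ _ (closure_neg_generators S) hinj
    (v := fun γ => ⟨u γ, subset_orbitSpace (hu γ)⟩)
    (fun γ => (mem_wordSpace_restrictRep _).2 (huw γ)) (fun γ => (hu γ).1) (fun γ => ?_)
    (fun γ => ?_)
  · have h1 : downE π (u (γ + -(((1, 0) : ZMod a × ZMod b) : G))) ∈
        wordSpace π (x.torus γ.out) := by
      rw [downE_eq_shiftOp, ← hstep γ (1, 0)]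
      convert! shiftOp_mem_wordSpace 1 0 (huw (γ + -(((1, 0) : ZMod a × ZMod b) : G))) using 2
      rw [InfWord.shift_torus ha hb]
      simp
    obtain ⟨c, hc, h⟩ := exists_smul_of_mem_orbitVectors hπ hη
      (downE_mem_orbitVectors hπ (hu _)) (hu γ) h1 (huw γ)
    refine ⟨c, hc, Subtype.ext ?_⟩
    rw [coe_downE_restrictRep]
    exact h
  · have h1 : downF π (u (γ + -(((0, 1) : ZMod a × ZMod b) : G))) ∈
        wordSpace π (x.torus γ.out) := by
      rw [downF_eq_shiftOp, ← hstep γ (0, 1)]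
      convert! shiftOp_mem_wordSpace 0 1 (huw (γ + -(((0, 1) : ZMod a × ZMod b) : G))) using 2
      rw [InfWord.shift_torus ha hb]
      simp
    obtain ⟨c, hc, h⟩ := exists_smul_of_mem_orbitVectors hπ hη
      (downF_mem_orbitVectors hπ (hu _)) (hu γ) h1 (huw γ)
    refine ⟨c, hc, Subtype.ext ?_⟩
    rw [coe_downF_restrictRep]
    exact h

end Dilation

/-! ### Existence of periodic eigenvectors -/

section Existence

variable {m n : ℕ} {θ : Equiv.Perm (Fin m × Fin n)}
  {H : Type*} [NormedAddCommGroup H] [InnerProductSpace ℂ H] [CompleteSpace H]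

omit [CompleteSpace H] in
lemma exists_common_eigenvector {ι : Type*} (T : ι → H →L[ℂ] H)
    (hT : ∀ i j v, T i (T j v) = T j (T i v)) (W : Submodule ℂ H) [FiniteDimensional ℂ W]
    (hW : W ≠ ⊥) (hinv : ∀ i, ∀ v ∈ W, T i v ∈ W) :
    ∃ v ∈ W, v ≠ 0 ∧ ∀ i, ∃ c : ℂ, T i v = c • v := by
  induction hd : Module.finrank ℂ W using Nat.strong_induction_on generalizing W with | _ d ih
  -- Unless every `T i` is scalar on `W`, an eigenspace of one of them is smaller and invariant.
  by_cases h : ∀ i, ∃ c : ℂ, ∀ v ∈ W, T i v = c • v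
  · obtain ⟨v, hv, hv0⟩ := W.ne_bot_iff.1 hW
    exact ⟨v, hv, hv0, fun i => (h i).imp fun c hc => hc v hv⟩
  push Not at h
  obtain ⟨i, hi⟩ := h
  have := Submodule.nontrivial_iff_ne_bot.2 hW
  obtain ⟨c, hc⟩ := Module.End.exists_eigenvalue ((T i).toLinearMap.restrict (hinv i))
  obtain ⟨u, hu⟩ := hc.exists_hasEigenvector
  have hu1 : T i u = c • (u : H) := congrArg Subtype.val hu.apply_eq_smul
  let W' : Submodule ℂ H := W ⊓ LinearMap.ker ((T i).toLinearMap - c • LinearMap.id)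
  have hmem : ∀ v, v ∈ W' ↔ v ∈ W ∧ T i v = c • v := fun v => by
    simp [W', sub_eq_zero]
  have hle : W' ≤ W := inf_le_left
  have hlt : W' < W := by
    refine lt_of_le_of_ne hle fun h => ?_
    obtain ⟨v, hv, hne⟩ := hi c
    exact hne ((hmem v).1 (h ▸ hv)).2
  have : FiniteDimensional ℂ W' := Submodule.finiteDimensional_of_le hle
  have hW' : W' ≠ ⊥ := W'.ne_bot_iff.2
    ⟨u, (hmem _).2 ⟨u.2, hu1⟩, fun h => hu.2 (Subtype.ext h)⟩
  obtain ⟨v, hv, h⟩ := ih _ (hd ▸ Submodule.finrank_lt_finrank_of_lt hlt) W' hW'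
    (fun j v hv => (hmem _).2 ⟨hinv j v (hle hv), by
      rw [hT, ((hmem v).1 hv).2, map_smul]⟩) rfl
  exact ⟨v, hle hv, h⟩

/-- A Cuntz family permuting an orthonormal basis up to scalars also steps backward along it. -/
lemma IsCuntzFamily.exists_down_basis {ι κ : Type*} [Fintype ι] {S : ι → H →L[ℂ] H}
    (hS : IsCuntzFamily S) (ξ : HilbertBasis κ ℂ H)
    (hξ : ∀ i k, ∃ (l : κ) (a : ℂ), (‖a‖ = 1 ∨ a = 0) ∧ S i (ξ k) = a • ξ l) (k : κ) :
    ∃ (i : ι) (l : κ) (c : ℂ), ‖c‖ = 1 ∧ down S (ξ k) = c • ξ l ∧ S i (down S (ξ k)) = ξ k := by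
  have h1 : ∃ i, adjoint (S i) (ξ k) ≠ 0 := by
    by_contra! h
    have h2 := hS.sum_apply (ξ k)
    simp only [h, map_zero, Finset.sum_const_zero] at h2
    exact ξ.orthonormal.ne_zero k h2.symm
  obtain ⟨i, hi⟩ := h1
  have h2 : ∃ l, ⟪ξ l, adjoint (S i) (ξ k)⟫_ℂ ≠ 0 := by
    by_contra! h
    refine hi ((ξ.hasSum_repr (adjoint (S i) (ξ k))).unique ?_)
    simp only [ξ.repr_apply_apply, h, zero_smul]
    exact hasSum_zero
  obtain ⟨l, hl⟩ := h2
  obtain ⟨l', a, ha, h⟩ := hξ i l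
  rw [adjoint_inner_right, h, inner_smul_left] at hl
  obtain rfl : l' = k := by
    by_contra hne
    exact hl (by rw [ξ.orthonormal.2 hne, mul_zero])
  have ha0 : a ≠ 0 := fun h => hl (by simp [h])
  have ha1 : ‖a‖ = 1 := ha.resolve_right ha0
  have h3 : ξ l' = S i (a⁻¹ • ξ l) := by
    rw [map_smul, h, smul_smul, inv_mul_cancel₀ ha0, one_smul]
  refine ⟨i, l, a⁻¹, by rw [norm_inv, ha1, inv_one], ?_, ?_⟩
  · rw [h3, hS.down_apply]
  · rw [h3, hS.down_apply]

lemma IsCuntzFamily.norm_starProjection_le {ι : Type*} [Fintype ι] {S : ι → H →L[ℂ] H}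
    (hS : IsCuntzFamily S) {M : Submodule ℂ H} [M.HasOrthogonalProjection]
    (hM : ∀ i, ∀ x ∈ M, adjoint (S i) x ∈ M) {i : ι} {v : H} (hv : S i (down S v) = v) :
    ‖M.starProjection v‖ ≤ ‖M.starProjection (down S v)‖ := by
  set x := M.starProjection v with hx
  have hxM : x ∈ M := M.starProjection_apply_mem v
  have hproj : ∀ y ∈ M, ∀ z, ⟪y, z⟫_ℂ = ⟪y, M.starProjection z⟫_ℂ := by
    intro y hy z
    rw [← Submodule.inner_starProjection_left_eq_right, Submodule.starProjection_eq_self_iff.2 hy]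
  have h1 : ⟪x, x⟫_ℂ = ⟪adjoint (S i) x, M.starProjection (down S v)⟫_ℂ := by
    conv_lhs => rw [hx]
    rw [← hx, ← hproj x hxM, ← hproj _ (hM i x hxM), adjoint_inner_left, hv]
  have h2 : ‖adjoint (S i) x‖ ≤ ‖x‖ := by
    rw [← sq_le_sq₀ (norm_nonneg _) (norm_nonneg _), ← hS.sum_norm_sq x]
    exact Finset.single_le_sum (f := fun i => ‖adjoint (S i) x‖ ^ 2) (fun _ _ => by positivity)
      (Finset.mem_univ i)
  have h3 : ‖x‖ * ‖x‖ ≤ ‖x‖ * ‖M.starProjection (down S v)‖ := by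
    rw [← inner_self_eq_norm_mul_norm (𝕜 := ℂ)]
    refine (RCLike.re_le_norm _).trans ?_
    rw [h1]
    exact (norm_inner_le_norm _ _).trans (by gcongr)
  rcases (norm_nonneg x).eq_or_lt with h | h
  · rw [← h]
    exact norm_nonneg _
  · exact le_of_mul_le_mul_left h3 h

omit [CompleteSpace H] in
lemma finite_setOf_le_norm_starProjection {κ : Type*} {ξ : κ → H} (hξ : Orthonormal ℂ ξ)
    (M : Submodule ℂ H) [FiniteDimensional ℂ M] {ε : ℝ} (hε : 0 < ε) :
    {k | ε ≤ ‖M.starProjection (ξ k)‖}.Finite := by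
  let b := stdOrthonormalBasis ℂ M
  have h1 : ∀ k, ‖M.starProjection (ξ k)‖ ^ 2 = ∑ i, ‖⟪ξ k, (b i : H)⟫_ℂ‖ ^ 2 := by
    intro k
    have h2 := b.sum_sq_norm_inner_left (M.orthogonalProjectionOnto (ξ k))
    rw [Submodule.starProjection_apply, ← Submodule.coe_norm, ← h2]
    refine Finset.sum_congr rfl fun i _ => ?_
    simp
  have h2 : Summable fun k => ‖M.starProjection (ξ k)‖ ^ 2 := by
    simp only [h1]
    exact summable_sum fun i _ => hξ.inner_products_summable (b i : H)
  have h3 := h2.tendsto_cofinite_zero.eventually (gt_mem_nhds (show (0 : ℝ) < ε ^ 2 by positivity))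
  refine (Filter.eventually_cofinite.1 h3).subset fun k hk => ?_
  have : ε ≤ ‖M.starProjection (ξ k)‖ := hk
  simpa using pow_le_pow_left₀ hε.le this 2

lemma exists_iterate_eq {κ : Type*} {F : Set κ} (hF : F.Finite) {p : κ → κ} {k : κ}
    (h : ∀ s, p^[s] k ∈ F) : ∃ s a, 0 < a ∧ p^[a] (p^[s] k) = p^[s] k := by
  have := hF.to_subtype
  obtain ⟨s, t, hne, hst⟩ := Finite.exists_ne_map_eq_of_infinite fun s => (⟨p^[s] k, h s⟩ : F)
  have hst' : p^[s] k = p^[t] k := congrArg Subtype.val hst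
  rcases hne.lt_or_gt with hlt | hlt
  · refine ⟨s, t - s, Nat.sub_pos_of_lt hlt, ?_⟩
    rw [← Function.iterate_add_apply, Nat.sub_add_cancel hlt.le, hst']
  · refine ⟨t, s - t, Nat.sub_pos_of_lt hlt, ?_⟩
    rw [← Function.iterate_add_apply, Nat.sub_add_cancel hlt.le, hst']

omit [CompleteSpace H] in
lemma _root_.HilbertBasis.eq_of_smul_eq {κ : Type*} (ξ : HilbertBasis κ ℂ H) {c d : ℂ} {k l : κ}
    (hc : ‖c‖ = 1) (h : c • ξ k = d • ξ l) : k = l := by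
  by_contra hne
  have h1 := congrArg (fun v => ⟪ξ k, v⟫_ℂ) h
  simp only [inner_smul_right, ξ.orthonormal.2 hne, mul_zero, mul_eq_zero, inner_self_eq_zero,
    ξ.orthonormal.ne_zero k, or_false] at h1
  simp [h1] at hc

/-- The backward steps map each vector of the orthonormal basis `ξ`, up to a unimodular scalar, to a
basis vector, `p` and `q` being the maps induced on the indices; the basis vectors are labelled by
infinite words. -/
structure IsBackwardStep {κ : Type*} (π : Rep θ H) (ξ : HilbertBasis κ ℂ H) (p q : κ → κ) :
    Prop where
  downE_eq : ∀ k, ∃ c : ℂ, ‖c‖ = 1 ∧ downE π (ξ k) = c • ξ (p k)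
  downF_eq : ∀ k, ∃ c : ℂ, ‖c‖ = 1 ∧ downF π (ξ k) = c • ξ (q k)
  exists_word : ∀ k, ∃ x, ξ k ∈ wordSpace π x

namespace IsBackwardStep

variable {π : Rep θ H} {κ : Type*} {ξ : HilbertBasis κ ℂ H} {p q : κ → κ}
  (h : IsBackwardStep π ξ p q)
include h

lemma shiftOp_eq (s t : ℕ) (k : κ) :
    ∃ c : ℂ, ‖c‖ = 1 ∧ shiftOp π s t (ξ k) = c • ξ (p^[s] (q^[t] k)) := by
  induction s with
  | zero =>
    induction t with
    | zero => exact ⟨1, by simp, by simp [shiftOp_zero]⟩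
    | succ t ih =>
      obtain ⟨c, hc, h1⟩ := ih
      obtain ⟨d, hd, h2⟩ := h.downF_eq (q^[t] k)
      refine ⟨c * d, by simp [hc, hd], ?_⟩
      rw [← downF_shiftOp, h1, map_smul, Function.iterate_zero_apply, h2, smul_smul,
        Function.iterate_succ_apply', Function.iterate_zero_apply]
  | succ s ih =>
    obtain ⟨c, hc, h1⟩ := ih
    obtain ⟨d, hd, h2⟩ := h.downE_eq (p^[s] (q^[t] k))
    refine ⟨c * d, by simp [hc, hd], ?_⟩
    rw [← downE_shiftOp, h1, map_smul, h2, smul_smul, Function.iterate_succ_apply']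

lemma commute : Function.Commute p q := by
  intro k
  obtain ⟨c, hc, h1⟩ := h.shiftOp_eq 1 1 k
  obtain ⟨d, hd, h2⟩ := h.downE_eq k
  obtain ⟨d', hd', h3⟩ := h.downF_eq (p k)
  have h4 : shiftOp π 1 1 (ξ k) = (d * d') • ξ (q (p k)) := by
    rw [← zero_add 1, ← downF_shiftOp, ← downE_eq_shiftOp, h2, map_smul, h3, smul_smul]
  exact ξ.eq_of_smul_eq hc (h1.symm.trans h4)

end IsBackwardStep

lemma exists_isBackwardStep {π : Rep θ H} (hπ : IsStarRep π) {κ : Type*} {ξ : HilbertBasis κ ℂ H}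
    (hξ : ∀ (w : FTheta θ) (k : κ), ∃ (l : κ) (a : ℂ), (‖a‖ = 1 ∨ a = 0) ∧ π w (ξ k) = a • ξ l) :
    ∃ p q, IsBackwardStep π ξ p q := by
  choose i p c hc hp hi using hπ.cuntz_e.exists_down_basis ξ fun i k => hξ (e θ i) k
  choose j q d hd hq hj using hπ.cuntz_f.exists_down_basis ξ fun j k => hξ (f θ j) k
  have hshift : ∀ k s t, ∃ (l : κ) (c : ℂ), shiftOp π s t (ξ k) = c • ξ l := by
    intro k s t
    induction s with
    | zero =>
      induction t with
      | zero => exact ⟨k, 1, by simp [shiftOp_zero]⟩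
      | succ t ih =>
        obtain ⟨l, a, h⟩ := ih
        refine ⟨q l, a * d l, ?_⟩
        rw [← downF_shiftOp, h, map_smul, mul_smul, ← hq]
        rfl
    | succ s ih =>
      obtain ⟨l, a, h⟩ := ih
      refine ⟨p l, a * c l, ?_⟩
      rw [← downE_shiftOp, h, map_smul, mul_smul, ← hp]
      rfl
  refine ⟨p, q, fun k => ⟨c k, hc k, hp k⟩, fun k => ⟨d k, hd k, hq k⟩, fun k => ?_⟩
  choose l a hl using hshift k
  refine ⟨fun s t => (i (l s t), j (l s t)), fun s t => ?_⟩
  rw [hl]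
  simp only [map_smul]
  exact ⟨congrArg _ (hi _), congrArg _ (hj _)⟩

lemma norm_starProjection_le_shiftOp {π : Rep θ H} (hπ : IsStarRep π) {M : Submodule ℂ H}
    [M.HasOrthogonalProjection] (hM : IsCoinvariant π M) {x : InfWord m n} {v : H}
    (hv : v ∈ wordSpace π x) (s t : ℕ) :
    ‖M.starProjection v‖ ≤ ‖M.starProjection (shiftOp π s t v)‖ := by
  induction s with
  | zero =>
    induction t with
    | zero => rw [shiftOp_zero]
    | succ t ih =>
      rw [← downF_shiftOp]
      exact ih.trans (hπ.cuntz_f.norm_starProjection_le (fun j => hM _) (hv 0 t).2)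
  | succ s ih =>
    rw [← downE_shiftOp]
    exact ih.trans (hπ.cuntz_e.norm_starProjection_le (fun i => hM _) (hv s t).1)

/-- The norms of the projections of the basis vectors to the finite dimensional coinvariant subspace
`M` are square summable and do not decrease under backward steps. Hence a basis vector not
orthogonal to `M` has a finite backward orbit. -/
lemma IsBackwardStep.finite_orbit {π : Rep θ H} (hπ : IsStarRep π) {κ : Type*}
    {ξ : HilbertBasis κ ℂ H} {p q : κ → κ} (h : IsBackwardStep π ξ p q) {M : Submodule ℂ H}
    [FiniteDimensional ℂ M] (hM : IsCoinvariant π M) {k : κ} (hk : M.starProjection (ξ k) ≠ 0) :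
    {l | ∃ s t, l = p^[s] (q^[t] k)}.Finite := by
  refine (finite_setOf_le_norm_starProjection ξ.orthonormal M (norm_pos_iff.2 hk)).subset ?_
  rintro _ ⟨s, t, rfl⟩
  obtain ⟨x, hx⟩ := h.exists_word k
  obtain ⟨c, hc, h1⟩ := h.shiftOp_eq s t k
  have h2 := norm_starProjection_le_shiftOp hπ hM hx s t
  rwa [h1, map_smul, norm_smul, hc, one_mul] at h2

lemma exists_inner_ne_zero_of_cyclic {π : Rep θ H} {M N : Submodule ℂ H}
    (hM : IsCyclicSubspace π M) (hN : IsReducing π N) (hN0 : N ≠ ⊥) :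
    ∃ x ∈ M, ∃ y ∈ N, ⟪x, y⟫_ℂ ≠ 0 := by
  by_contra! h
  refine hN0 (eq_bot_iff.2 fun y hy => ?_)
  have h1 : (⨆ w : FTheta θ, M.map (π w).toLinearMap).topologicalClosure ≤ Nᗮ := by
    refine Submodule.topologicalClosure_minimal _ (iSup_le fun w => ?_) N.isClosed_orthogonal
    rintro _ ⟨x, hx, rfl⟩
    refine (N.mem_orthogonal' _).2 fun z hz => ?_
    change ⟪π w x, z⟫_ℂ = 0
    rw [← adjoint_inner_right]
    exact h x hx _ (hN.coinvariant w z hz)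
  rw [hM] at h1
  exact inner_self_eq_zero.1 ((N.mem_orthogonal _).1 (h1 (Submodule.mem_top (x := y))) y hy)

/-- Every nonzero reducing subspace `N` contains a periodic eigenvector. Some basis vector with a
finite backward orbit projects nontrivially to `N`; far enough back its word `x` is periodic. The
steps that fix `x` act on the span of the projections to `N` of the vectors of the orbit, and
commute there. -/
lemma exists_isPeriodicEigenvector {H : Type u} [NormedAddCommGroup H] [InnerProductSpace ℂ H]
    [CompleteSpace H] {π : Rep θ H} (hπ : IsStarRep π)
    (hatomic : IsAtomic π) (hfc : IsFinitelyCorrelated π) {N : Submodule ℂ H}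
    (hN : IsReducing π N) (hN0 : N ≠ ⊥) :
    ∃ x a b η, IsPeriodicEigenvector π x a b η ∧ η ∈ N := by
  obtain ⟨-, κ, ξ, hξ⟩ := hatomic
  obtain ⟨M, hMfin, hMco, hMcyc⟩ := hfc
  have := hN.hasOrthogonalProjection
  have hR := hN.intertwining
  obtain ⟨p, q, h⟩ := exists_isBackwardStep hπ hξ
  obtain ⟨k, hkM, hkN⟩ : ∃ k, M.starProjection (ξ k) ≠ 0 ∧ N.starProjection (ξ k) ≠ 0 := by
    obtain ⟨x, hx, y, hy, hxy⟩ := exists_inner_ne_zero_of_cyclic hMcyc hN hN0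
    by_contra! hk
    refine hxy ((ξ.hasSum_inner_mul_inner x y).unique ?_)
    convert! hasSum_zero using 2 with k
    by_cases hM0 : M.starProjection (ξ k) = 0
    · rw [Submodule.starProjection_apply_eq_zero_iff] at hM0
      rw [(M.mem_orthogonal _).1 hM0 x hx, zero_mul]
    · have hN0 := hk k hM0
      rw [Submodule.starProjection_apply_eq_zero_iff] at hN0
      rw [(N.mem_orthogonal' _).1 hN0 y hy, mul_zero]
  have hfin := h.finite_orbit hπ hMco hkM
  have hpq : ∀ s t k', p^[s] (q^[t] k') = q^[t] (p^[s] k') := fun s t k' =>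
    (h.commute.iterate_iterate s t) k'
  obtain ⟨s₀, a, ha, hpa⟩ := exists_iterate_eq hfin (p := p) (k := k) fun s => ⟨s, 0, rfl⟩
  obtain ⟨t₀, b, hb, hqb⟩ := exists_iterate_eq hfin (p := q) (k := p^[s₀] k)
    fun t => ⟨s₀, t, (hpq _ _ _).symm⟩
  set k₀ := q^[t₀] (p^[s₀] k) with hk₀
  have hpa₀ : p^[a] k₀ = k₀ := by rw [hk₀, hpq, hpa]
  have hk₀' : k₀ = p^[s₀] (q^[t₀] k) := (hpq _ _ _).symm
  obtain ⟨x, hx⟩ := h.exists_word k₀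
  have hword : ∀ s t, p^[s] (q^[t] k₀) = k₀ → x.shift s t = x := by
    intro s t hst
    obtain ⟨c, hc, h1⟩ := h.shiftOp_eq s t k₀
    have h2 : shiftOp π s t (ξ k₀) ∈ wordSpace π x := by
      rw [h1, hst]
      exact Submodule.smul_mem _ _ hx
    refine word_unique hπ (shiftOp_mem_wordSpace s t hx) h2 fun h0 => ?_
    have h3 := norm_shiftOp hπ s t hx
    rw [h0, norm_zero, ξ.orthonormal.1] at h3
    exact zero_ne_one h3
  have hk₀N : N.starProjection (ξ k₀) ≠ 0 := by
    intro h0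
    obtain ⟨y, hy⟩ := h.exists_word k
    obtain ⟨c, -, h1⟩ := h.shiftOp_eq s₀ t₀ k
    apply hkN
    rw [← norm_eq_zero, ← norm_shiftOp hπ s₀ t₀ (hR.mem_wordSpace hy), ← hR.shiftOp_comm, h1,
      ← hk₀', map_smul, h0, smul_zero, norm_zero]
  -- The part of the backward orbit of `ξ k₀` that carries the same word `x`.
  let O : Set κ := {l | ∃ s t, x.shift s t = x ∧ l = p^[s] (q^[t] k₀)}
  have hO : O.Finite := by
    refine hfin.subset ?_
    rintro _ ⟨s, t, -, rfl⟩
    refine ⟨s + s₀, t + t₀, ?_⟩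
    rw [hk₀', ← hpq s₀ t, ← Function.iterate_add_apply, ← Function.iterate_add_apply]
  let W : Submodule ℂ H := Submodule.span ℂ ((fun l => N.starProjection (ξ l)) '' O)
  have : FiniteDimensional ℂ W := FiniteDimensional.span_of_finite ℂ (hO.image _)
  have hk₀O : k₀ ∈ O := ⟨0, 0, rfl, rfl⟩
  have hW0 : W ≠ ⊥ := W.ne_bot_iff.2 ⟨_, Submodule.subset_span ⟨k₀, hk₀O, rfl⟩, hk₀N⟩
  have hWN : W ≤ N := Submodule.span_le.2 <| by
    rintro _ ⟨l, -, rfl⟩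
    exact N.starProjection_apply_mem _
  have hWx : W ≤ wordSpace π x := Submodule.span_le.2 <| by
    rintro _ ⟨_, ⟨s, t, hst, rfl⟩, rfl⟩
    refine hR.mem_wordSpace ?_
    obtain ⟨c, hc, h1⟩ := h.shiftOp_eq s t k₀
    have hc0 : c ≠ 0 := fun h => by simp [h] at hc
    have h2 := shiftOp_mem_wordSpace s t hx
    rw [hst, h1] at h2
    exact (Submodule.smul_mem_iff _ hc0).1 h2
  obtain ⟨v, hvW, hv0, hv⟩ := exists_common_eigenvector
    (fun z : {z : ℕ × ℕ // x.shift z.1 z.2 = x} => shiftOp π z.1.1 z.1.2)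
    (fun _ _ _ => shiftOp_comm _ _ _ _ _) W hW0 (by
      rintro ⟨⟨s, t⟩, hst⟩ v hv
      refine (Submodule.span_le (p := W.comap (shiftOp π s t).toLinearMap)).2 ?_ hv
      rintro _ ⟨_, ⟨s', t', hst', rfl⟩, rfl⟩
      change shiftOp π s t (N.starProjection _) ∈ W
      obtain ⟨c, -, h1⟩ := h.shiftOp_eq s t (p^[s'] (q^[t'] k₀))
      rw [← hR.shiftOp_comm, h1, map_smul]
      refine Submodule.smul_mem _ _ (Submodule.subset_span ⟨_, ⟨s + s', t + t', ?_, ?_⟩, rfl⟩)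
      · rw [← InfWord.shift_shift, hst', hst]
      · rw [← hpq s' t, ← Function.iterate_add_apply, ← Function.iterate_add_apply])
  have hnorm : (‖v‖ : ℂ)⁻¹ ≠ 0 := by simpa using hv0
  refine ⟨x, a, b, (‖v‖ : ℂ)⁻¹ • v, ⟨Submodule.smul_mem _ _ (hWx hvW), ?_, ha, hb,
    hword a 0 hpa₀, hword 0 b hqb, fun s t hst => ?_⟩, Submodule.smul_mem _ _ (hWN hvW)⟩
  · rw [norm_smul, norm_inv, Complex.norm_real, norm_norm, inv_mul_cancel₀ (norm_ne_zero_iff.2 hv0)]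
  · obtain ⟨c, hc⟩ := hv ⟨(s, t), hst⟩
    exact ⟨c, by rw [map_smul, hc, smul_comm]⟩

end Existence

/-! ### The decomposition -/

section Decomposition

variable {m n : ℕ} {θ : Equiv.Perm (Fin m × Fin n)}
  {H : Type u} [NormedAddCommGroup H] [InnerProductSpace ℂ H] [CompleteSpace H]

/-- If every nonzero reducing subspace contains a nonzero reducing subspace satisfying `P`, then the
whole space is the Hilbert sum of a family of such subspaces, by Zorn's lemma. -/
lemma exists_isHilbertSum_reducing {π : Rep θ H} {P : Submodule ℂ H → Prop}
    (hred : ∀ K, P K → IsReducing π K) (hne : ∀ K, P K → K ≠ ⊥)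
    (hex : ∀ N, IsReducing π N → N ≠ ⊥ → ∃ K, P K ∧ K ≤ N) :
    ∃ A : Set (Submodule ℂ H), (∀ K ∈ A, P K) ∧
      IsHilbertSum ℂ (fun K : A => (K : Submodule ℂ H)) fun K => (K : Submodule ℂ H).subtypeₗᵢ := by
  obtain ⟨A, hA⟩ := zorn_subset
    {A : Set (Submodule ℂ H) | (∀ K ∈ A, P K) ∧ A.Pairwise fun K L => K ⟂ L} (by
      refine fun c hc hchain => ⟨⋃₀ c, ⟨?_, ?_⟩, fun s hs => Set.subset_sUnion_of_mem hs⟩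
      · rintro K ⟨B, hB, hK⟩
        exact (hc hB).1 K hK
      · exact (Set.pairwise_sUnion hchain.directedOn).2 fun B hB => (hc hB).2)
  refine ⟨A, hA.1.1, ?_⟩
  have : ∀ K : A, CompleteSpace (K : Submodule ℂ H) := fun K =>
    (hred K (hA.1.1 K K.2)).isClosed.completeSpace_coe
  refine IsHilbertSum.mkInternal _ (OrthogonalFamily.of_pairwise fun K L hKL => ?_) ?_
  · exact hA.1.2 K.2 L.2 fun h => hKL (Subtype.ext h)
  set T : Submodule ℂ H := ⨆ K : A, (K : Submodule ℂ H) with hT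
  have hTred : IsReducing π Tᗮ := by
    have hmem : ∀ x, x ∈ Tᗮ ↔ ∀ K : A, x ∈ (K : Submodule ℂ H)ᗮ := fun x => by
      rw [hT, ← Submodule.iInf_orthogonal, Submodule.mem_iInf]
    refine ⟨T.isClosed_orthogonal, fun w x hx => ?_, fun w x hx => ?_⟩
    · exact (hmem _).2 fun K => (hred K (hA.1.1 K K.2)).orthogonal.map_mem w x ((hmem x).1 hx K)
    · exact (hmem _).2 fun K => (hred K (hA.1.1 K K.2)).orthogonal.coinvariant w x ((hmem x).1 hx K)
  rw [top_le_iff, Submodule.topologicalClosure_eq_top_iff]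
  by_contra hT0
  obtain ⟨L, hL, hLT⟩ := hex _ hTred hT0
  have hperp : ∀ K ∈ A, L ⟂ K := fun K hK =>
    hLT.trans (Submodule.orthogonal_le (le_iSup (fun K : A => (K : Submodule ℂ H)) ⟨K, hK⟩))
  have hLA : L ∉ A := fun h => hne L hL (Submodule.isOrtho_self.1 (hperp L h))
  refine hLA (hA.2 (y := insert L A) ⟨?_, ?_⟩ (Set.subset_insert _ _) (Set.mem_insert _ _))
  · rintro K (rfl | hK)
    · exact hL
    · exact hA.1.1 K hK
  · exact hA.1.2.insert fun K hK _ => ⟨hperp K hK, (hperp K hK).symm⟩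

/-- The coordinates of a vector in a Hilbert sum of reducing subspaces are its projections, and
these commute with the representation. -/
lemma isUnitarilyEquivalentToDirectSum_of_isHilbertSum {π : Rep θ H} {ι : Type*}
    {K : ι → Submodule ℂ H} (hK : ∀ i, IsReducing π (K i))
    (hsum : IsHilbertSum ℂ (fun i => K i) fun i => (K i).subtypeₗᵢ) :
    IsUnitarilyEquivalentToDirectSum π fun i => restrictRep (hK i) := by
  classical
  have : ∀ i, CompleteSpace (K i) := fun i => (hK i).isClosed.completeSpace_coe
  refine ⟨hsum.linearIsometryEquiv, fun w x i => ?_⟩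
  have hcoord : ∀ (z : H) (y : K i), ⟪y, hsum.linearIsometryEquiv z i⟫_ℂ = ⟪(y : H), z⟫_ℂ := by
    intro z y
    refine (lp.inner_single_left (𝕜 := ℂ) i y (hsum.linearIsometryEquiv z)).symm.trans ?_
    rw [← hsum.linearIsometryEquiv.symm.inner_map_map,
      hsum.linearIsometryEquiv_symm_apply_single, LinearIsometryEquiv.symm_apply_apply]
    rfl
  refine ext_inner_left ℂ fun y => ?_
  rw [hcoord, ← adjoint_inner_left, ← adjoint_inner_left (restrictRep (hK i) w), hcoord,
    coe_adjoint_restrictRep]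

end Decomposition

end TwoGraph

theorem corollaryf {m n : ℕ} (θ : Equiv.Perm (Fin m × Fin n))
    {H : Type u} [NormedAddCommGroup H] [InnerProductSpace ℂ H] [CompleteSpace H]
    (π : TwoGraph.Rep θ H) (hstar : TwoGraph.IsStarRep π) (hatomic : TwoGraph.IsAtomic π)
    (hfc : TwoGraph.IsFinitelyCorrelated π) :
    ∃ (ι : Type u) (K : ι → Type u) (_ : ∀ i, NormedAddCommGroup (K i))
      (_ : ∀ i, InnerProductSpace ℂ (K i)) (_ : ∀ i, CompleteSpace (K i))
      (ρ : ∀ i, TwoGraph.Rep θ (K i)),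
      TwoGraph.IsUnitarilyEquivalentToDirectSum π ρ ∧
      ∀ i, TwoGraph.IsStarRep (ρ i) ∧ TwoGraph.IsAtomic (ρ i) ∧ TwoGraph.IsIrreducible (ρ i) ∧
        ∃ (G : Type) (_ : AddCommGroup G) (_ : Finite G)
          (σ : TwoGraph.Rep θ (lp (fun _ : G => ℂ) 2)),
          TwoGraph.IsGroupConstruction σ ∧ TwoGraph.IsDilation (ρ i) σ := by
  obtain ⟨A, hA, hsum⟩ := TwoGraph.exists_isHilbertSum_reducing (π := π)
    (P := fun K => ∃ x a b η, TwoGraph.IsPeriodicEigenvector π x a b η ∧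
      K = TwoGraph.orbitSpace π η)
    (by
      rintro _ ⟨x, a, b, η, -, rfl⟩
      exact TwoGraph.isReducing_orbitSpace hstar)
    (by
      rintro _ ⟨x, a, b, η, hη, rfl⟩ h
      have h1 := TwoGraph.subset_orbitSpace (TwoGraph.self_mem_orbitVectors hstar hη)
      rw [h] at h1
      have h2 : η = 0 := h1
      simpa [h2] using hη.norm_eq)
    (fun N hN hN0 => by
      obtain ⟨x, a, b, η, hη, hηN⟩ :=
        TwoGraph.exists_isPeriodicEigenvector hstar hatomic hfc hN hN0
      exact ⟨_, ⟨x, a, b, η, hη, rfl⟩, TwoGraph.orbitSpace_le hstar hN hηN⟩)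
  have hred : ∀ K : A, TwoGraph.IsReducing π (K : Submodule ℂ H) := by
    rintro ⟨K, hK⟩
    obtain ⟨x, a, b, η, -, rfl⟩ := hA K hK
    exact TwoGraph.isReducing_orbitSpace hstar
  have hcomplete : ∀ K : A, CompleteSpace (K : Submodule ℂ H) := fun K =>
    (hred K).isClosed.completeSpace_coe
  refine ⟨A, fun K => (K : Submodule ℂ H), fun _ => inferInstance, fun _ => inferInstance,
    hcomplete, fun K => TwoGraph.restrictRep (hred K),
    TwoGraph.isUnitarilyEquivalentToDirectSum_of_isHilbertSum hred hsum, ?_⟩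
  rintro ⟨K, hK⟩
  have := hcomplete ⟨K, hK⟩
  obtain ⟨x, a, b, η, hη, rfl⟩ := hA K hK
  exact ⟨TwoGraph.isStarRep_restrictRep hstar _, TwoGraph.isAtomic_restrictRep_orbitSpace hstar hη,
    TwoGraph.isIrreducible_restrictRep_orbitSpace hstar hη,
    TwoGraph.exists_isDilation_restrictRep_orbitSpace hstar hη⟩
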